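/- **Setting.** Identify $\mathbb{R}^2$ with $\mathbb{C}$. Let $D\subset\mathbb{R}^2$ be a bounded domain of class $\mathcal{C}^2$ with outward unit normal $\nu$ and arc length $ds$ on $\partial D$, let $\kappa>1$ and $\lambda=\frac{\kappa+1}{2(\kappa-1)}$. On $L^2(\partial D)$ let $$\mathcal{K}_D^*[\varphi](x)=\frac1{2\pi}\int_{\partial D}\frac{\langle x-y,\nu_x\rangle}{|x-y|^2}\,\varphi(y)\,ds(y),\qquad x\in\partial D .$$ For $\alpha,\beta\in\mathbb{N}^2$ define the generalized polarization tensors (with $y^\alpha=y_1^{\alpha_1}y_2^{\alpha_2}$) $$M_{\alpha\beta}(D)=\int_{\partial D}y^\beta\,(\lambda I-\mathcal{K}_D^*)^{-1}\Big[\frac{\partial y^\alpha}{\partial\nu}\Big](y)\,ds(y).$$ Let the real numbers $a^m_\alpha,b^m_\alpha$ ($|\alpha|=m$) be given by $(x_1+ix_2)^m=\sum_{|\alpha|=m}a^m_\alpha x^\alpha+i\sum_{|\alpha|=m}b^m_\alpha x^\alpha$, and for $m,n\ge1$ put $$M^{cc}_{mn}=\sum_{|\alpha|=m}\sum_{|\beta|=n}a^m_\alpha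 a^n_\beta M_{\alpha\beta},\quad M^{cs}_{mn}=\sum_{|\alpha|=m}\sum_{|\beta|=n}a^m_\alpha b^n_\beta M_{\alpha\beta},$$ $$M^{sc}_{mn}=\sum_{|\alpha|=m}\sum_{|\beta|=n}b^m_\alpha a^n_\beta M_{\alpha\beta},\quad M^{ss}_{mn}=\sum_{|\alpha|=m}\sum_{|\beta|=n}b^m_\alpha b^n_\beta M_{\alpha\beta}.$$ The complex contracted generalized polarization tensors (complex CGPTs) of $D$ are $$N^{(1)}_{mn}(D)=(M^{cc}_{mn}-M^{ss}_{mn})+i(M^{cs}_{mn}+M^{sc}_{mn}),\qquad N^{(2)}_{mn}(D)=(M^{cc}_{mn}+M^{ss}_{mn})+i(M^{cs}_{mn}-M^{sc}_{mn}).$$ For $\theta\in\mathbb{R}$, $s>0$, $z\in\mathbb{C}$ let $R_\theta D=\{e^{i\theta}x:x\in D\}$, $sD=\{sx:x\in D\}$, $T_zD=\{x+z:x\in D\}$, and let $\mathbf{C}^z$ be the lower triangular matrix with entries $\mathbf{C}^z_{mn}=\binom{m}{n}z^{m-n}$ for $1\le n\le m$ (and $0$ for $n>m$). **Proposition.** For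 all integers $m,n\ge1$, all $\theta\in\mathbb{R}$, $s>0$ and $z\in\mathbb{C}$: $$N^{(1)}_{mn}(R_\theta D)=e^{i(m+n)\theta}N^{(1)}_{mn}(D),\qquad N^{(2)}_{mn}(R_\theta D)=e^{i(n-m)\theta}N^{(2)}_{mn}(D),$$ $$N^{(1)}_{mn}(sD)=s^{m+n}N^{(1)}_{mn}(D),\qquad N^{(2)}_{mn}(sD)=s^{m+n}N^{(2)}_{mn}(D),$$ $$N^{(1)}_{mn}(T_zD)=\sum_{l=1}^m\sum_{k=1}^n\mathbf{C}^z_{ml}\,N^{(1)}_{lk}(D)\,\mathbf{C}^z_{nk},\qquad N^{(2)}_{mn}(T_zD)=\sum_{l=1}^m\sum_{k=1}^n\overline{\mathbf{C}^z_{ml}}\,N^{(2)}_{lk}(D)\,\mathbf{C}^z_{nk}.$$ -/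

import Mathlib

open MeasureTheory Filter Topology
open scoped InnerProductSpace

noncomputable section

/-- The plane `ℝ²` is identified with `ℂ` throughout; `⟪x, y⟫_ℝ` is the Euclidean scalar product.

A bounded domain of class `C²`: a bounded, connected (hence nonempty), open set which, near each of
its boundary points and after a rotation of the axes (`x ↦ c * x`, with `c` of modulus one), is the
set of points lying strictly above the graph of a `C²` function. -/
structure IsBoundedC2Domain (D : Set ℂ) : Prop where
  isOpen : IsOpen D
  isConnected : IsConnected D
  isBounded : Bornology.IsBounded D
  exists_graph : ∀ p ∈ frontier D, ∃ (c : ℂ) (r : ℝ) (γ : ℝ → ℝ),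
    ‖c‖ = 1 ∧ 0 < r ∧ ContDiff ℝ 2 γ ∧
      ∀ x ∈ Metric.ball p r, x ∈ D ↔ γ (c * x).re < (c * x).im

/-- `ν` is an outward unit normal vector of `D` at `p`: near `p`, every open cone around `-ν`
strictly smaller than a half-plane is inside `D`, and every such cone around `ν` is outside. -/
def IsOuterUnitNormal (D : Set ℂ) (p ν : ℂ) : Prop :=
  ‖ν‖ = 1 ∧ ∀ ε > 0, ∀ᶠ y in 𝓝 p,
    (⟪y - p, ν⟫_ℝ < -(ε * ‖y - p‖) → y ∈ D) ∧ (ε * ‖y - p‖ < ⟪y - p, ν⟫_ℝ → y ∉ D)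

/-- There is at most one outward unit normal vector. -/
theorem IsOuterUnitNormal.unique {D : Set ℂ} {p ν μ : ℂ}
    (hν : IsOuterUnitNormal D p ν) (hμ : IsOuterUnitNormal D p μ) : ν = μ := by
  by_contra hne
  have hv : 0 < ‖μ - ν‖ := norm_pos_iff.2 (sub_ne_zero.2 (Ne.symm hne))
  have hsq : ‖μ - ν‖ ^ 2 = 2 - 2 * ⟪μ, ν⟫_ℝ := by
    rw [norm_sub_sq_real, hν.1, hμ.1]; ring
  set d : ℝ := 1 - ⟪μ, ν⟫_ℝ with hd
  have hdpos : 0 < d := by nlinarith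
  have h1 : ⟪μ - ν, ν⟫_ℝ = -d := by
    rw [inner_sub_left, real_inner_self_eq_norm_sq, hν.1]; ring
  have h2 : ⟪μ - ν, μ⟫_ℝ = d := by
    rw [inner_sub_left, real_inner_self_eq_norm_sq, hμ.1, real_inner_comm]; ring
  have hε : 0 < d / (2 * ‖μ - ν‖) := by positivity
  have hcont : Tendsto (fun t : ℝ => p + t • (μ - ν)) (𝓝[>] 0) (𝓝 p) := by
    have : Tendsto (fun t : ℝ => p + t • (μ - ν)) (𝓝 0) (𝓝 (p + (0 : ℝ) • (μ - ν))) :=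
      Continuous.tendsto (by fun_prop) 0
    simp only [zero_smul, add_zero] at this
    exact this.mono_left nhdsWithin_le_nhds
  have hev := ((hcont.eventually (hν.2 _ hε)).and (hcont.eventually (hμ.2 _ hε))).and
    (self_mem_nhdsWithin (s := Set.Ioi (0 : ℝ)))
  obtain ⟨t, ⟨hA, hB⟩, ht⟩ := hev.exists
  have ht : 0 < t := ht
  have hnorm : d / (2 * ‖μ - ν‖) * ‖p + t • (μ - ν) - p‖ = t * (d / 2) := by
    rw [add_sub_cancel_left, norm_smul, Real.norm_of_nonneg ht.le]
    field_simp
  have htd : 0 < t * d := mul_pos ht hdpos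
  refine (hB.2 ?_) (hA.1 ?_)
  · rw [hnorm, add_sub_cancel_left, real_inner_smul_left, h2]; linarith
  · rw [hnorm, add_sub_cancel_left, real_inner_smul_left, h1]; linarith

/-- Every boundary point of a bounded `C²` domain has an outward unit normal vector. -/
theorem IsBoundedC2Domain.exists_isOuterUnitNormal {D : Set ℂ} (hD : IsBoundedC2Domain D)
    {p : ℂ} (hp : p ∈ frontier D) : ∃ ν, IsOuterUnitNormal D p ν := by
  obtain ⟨c, r, γ, hc, hr, hγ, hD'⟩ := hD.exists_graph p hp
  have hcc : (starRingEnd ℂ) c * c = 1 := by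
    rw [mul_comm, Complex.mul_conj, Complex.normSq_eq_norm_sq, hc]; simp
  have hpD : p ∉ D := by
    have := hp.2
    rwa [hD.isOpen.interior_eq] at this
  have hball : Metric.ball p r ∈ 𝓝 p := Metric.ball_mem_nhds p hr
  have hp0 : (c * p).im = γ (c * p).re := by
    apply le_antisymm
    · by_contra h
      exact hpD ((hD' p (Metric.mem_ball_self hr)).2 (not_le.1 h))
    · by_contra h
      have hopen : ∀ᶠ y in 𝓝 p, (c * y).im < γ (c * y).re := by
        have hγc := hγ.continuous
        exact (isOpen_lt (by fun_prop) (by fun_prop)).mem_nhds (not_le.1 h)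
      obtain ⟨y, ⟨hy1, hy2⟩, hyD⟩ :=
        mem_closure_iff_nhds.1 hp.1 _ (Filter.inter_mem hopen hball)
      exact lt_asymm ((hD' y hy2).1 hyD) hy1
  set a := deriv γ (c * p).re with ha
  set L := Real.sqrt (1 + a ^ 2) with hL
  have hL1 : 1 ≤ L := Real.one_le_sqrt.2 (by nlinarith [sq_nonneg a])
  have hL0 : 0 < L := by linarith
  have hLsq : L ^ 2 = 1 + a ^ 2 := Real.sq_sqrt (by positivity)
  have hder : HasDerivAt γ a (c * p).re :=
    ((hγ.differentiable (by norm_num)) _).hasDerivAt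
  have hin : ∀ y, ⟪y - p, (starRingEnd ℂ) c * (⟨a / L, -1 / L⟩ : ℂ)⟫_ℝ =
      (a * (c * (y - p)).re - (c * (y - p)).im) / L := by
    intro y
    rw [Complex.inner]
    simp only [Complex.mul_re, Complex.mul_im, Complex.conj_re, Complex.conj_im]
    field_simp
    ring
  refine ⟨(starRingEnd ℂ) c * (⟨a / L, -1 / L⟩ : ℂ), ?_, ?_⟩
  · rw [norm_mul, RCLike.norm_conj, hc, one_mul, Complex.norm_def, Complex.normSq_mk,
      Real.sqrt_eq_one]
    field_simp
    linarith
  · intro ε hε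
    have hlim : Tendsto (fun y : ℂ => (c * y).re) (𝓝 p) (𝓝 (c * p).re) :=
      Continuous.tendsto (by fun_prop) p
    have ho := hlim.eventually ((hasDerivAt_iff_isLittleO.1 hder).def hε)
    filter_upwards [ho, hball] with y hy hyb
    rw [hin, hD' y hyb]
    have hre : (c * y).re - (c * p).re = (c * (y - p)).re := by rw [mul_sub, Complex.sub_re]
    have him : (c * y).im - (c * p).im = (c * (y - p)).im := by rw [mul_sub, Complex.sub_im]
    have hu : |(c * (y - p)).re| ≤ ‖y - p‖ := by
      refine (Complex.abs_re_le_norm _).trans ?_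
      rw [norm_mul, hc, one_mul]
    rw [hre, smul_eq_mul, Real.norm_eq_abs, Real.norm_eq_abs] at hy
    have hy' := abs_le.1 (hy.trans (mul_le_mul_of_nonneg_left hu hε.le))
    have hεL : ε * ‖y - p‖ ≤ ε * ‖y - p‖ * L :=
      le_mul_of_one_le_right (by positivity) hL1
    constructor
    · intro h
      rw [div_lt_iff₀ hL0] at h
      nlinarith [hy'.2]
    · intro h
      rw [lt_div_iff₀ hL0] at h
      rw [not_lt]
      nlinarith [hy'.1]

open Classical in
/-- The outward unit normal `ν_p` of `D` at `p` (with value `0` at the points having none). -/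
def outerNormal (D : Set ℂ) (p : ℂ) : ℂ :=
  if h : ∃ ν, IsOuterUnitNormal D p ν then h.choose else 0

/-- The arc length measure `ds` on `∂D`. -/
def bdryMeasure (D : Set ℂ) : Measure ℂ :=
  (μH[1] : Measure ℂ).restrict (frontier D)

/-- The complex Hilbert space `L²(∂D)`. -/
abbrev BdryL2 (D : Set ℂ) : Type := Lp ℂ 2 (bdryMeasure D)

/-- The integral `𝒦_D^*[φ](x) = (1 / 2π) ∫_{∂D} ⟨x - y, ν_x⟩ / |x - y|² φ(y) ds(y)`. -/
def npAdjoint (D : Set ℂ) (φ : ℂ → ℂ) (x : ℂ) : ℂ :=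
  ((1 / (2 * Real.pi) : ℝ) : ℂ) *
    ∫ y, ((⟪x - y, outerNormal D x⟫_ℝ / ‖x - y‖ ^ 2 : ℝ) : ℂ) * φ y ∂(bdryMeasure D)

/-- `R` is the inverse of the operator `lam I - 𝒦_D^*` of `L²(∂D)`: for all `φ, g ∈ L²(∂D)` one has
`R g = φ` if and only if `(lam I - 𝒦_D^*) φ = g`. -/
def IsInverseNP (lam : ℝ) (D : Set ℂ) (R : BdryL2 D → BdryL2 D) : Prop :=
  ∀ φ g : BdryL2 D, R g = φ ↔
    ∀ᵐ x ∂(bdryMeasure D), (lam : ℂ) * φ x - npAdjoint D φ x = g x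

open Classical in
/-- The operator `(lam I - 𝒦_D^*)⁻¹` of `L²(∂D)` (and `0` if `lam I - 𝒦_D^*` is not invertible,
which does not happen for `lam > 1 / 2` and a bounded `C²` domain `D`). -/
def inverseNP (lam : ℝ) (D : Set ℂ) : BdryL2 D → BdryL2 D :=
  if h : ∃ R, IsInverseNP lam D R then h.choose else 0

open Classical in
/-- A square-integrable function on `∂D` as an element of `L²(∂D)`. -/
def toBdryL2 (D : Set ℂ) (g : ℂ → ℂ) : BdryL2 D :=
  if h : MemLp g 2 (bdryMeasure D) then h.toLp g else 0

/-- The normal derivative `∂f/∂ν = ⟨ν, ∇f⟩` on `∂D`. -/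
def normalDeriv (D : Set ℂ) (f : ℂ → ℂ) (y : ℂ) : ℂ :=
  fderiv ℝ f y (outerNormal D y)

/-- The monomial `y^α = y₁^α₁ y₂^α₂`. -/
def planeMonomial (α : ℕ × ℕ) (y : ℂ) : ℂ :=
  ((y.re ^ α.1 * y.im ^ α.2 : ℝ) : ℂ)

/-- The generalized polarization tensor
`M_{αβ}(lam, D) = ∫_{∂D} y^β (lam I - 𝒦_D^*)⁻¹[∂y^α/∂ν](y) ds(y)`. -/
def gpt (lam : ℝ) (D : Set ℂ) (α β : ℕ × ℕ) : ℂ :=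
  ∫ y, planeMonomial β y * inverseNP lam D (toBdryL2 D (normalDeriv D (planeMonomial α))) y
    ∂(bdryMeasure D)

/-- The real part `a^m_α` of the coefficient of `x^α`, `|α| = m`, in `(x₁ + i x₂)^m`. -/
def coeffA (m : ℕ) (α : ℕ × ℕ) : ℝ := ((m.choose α.2 : ℂ) * Complex.I ^ α.2).re

/-- The imaginary part `b^m_α` of the coefficient of `x^α`, `|α| = m`, in `(x₁ + i x₂)^m`. -/
def coeffB (m : ℕ) (α : ℕ × ℕ) : ℝ := ((m.choose α.2 : ℂ) * Complex.I ^ α.2).im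

/-- The defining expansion of the coefficients `a^m_α` and `b^m_α`. -/
theorem pow_eq_sum_coeff (m : ℕ) (x : ℂ) :
    x ^ m = ∑ α ∈ Finset.HasAntidiagonal.antidiagonal m, (coeffA m α : ℂ) * planeMonomial α x +
      Complex.I * ∑ β ∈ Finset.HasAntidiagonal.antidiagonal m, (coeffB m β : ℂ) * planeMonomial β x := by
  rw [Finset.mul_sum, ← Finset.sum_add_distrib]
  conv_lhs => rw [← Complex.re_add_im x, (Commute.all _ _).add_pow']
  refine Finset.sum_congr rfl fun α hα => ?_
  have hα' : m = α.1 + α.2 := (Finset.HasAntidiagonal.mem_antidiagonal.1 hα).symm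
  have hcoeff : (coeffA m α : ℂ) + Complex.I * (coeffB m α : ℂ) =
      (m.choose α.2 : ℂ) * Complex.I ^ α.2 := by
    rw [mul_comm Complex.I]
    exact Complex.re_add_im _
  rw [← mul_assoc, ← add_mul, hcoeff, Nat.choose_symm_of_eq_add hα', nsmul_eq_mul, planeMonomial,
    mul_pow]
  push_cast
  ring

/-- `∑_{|α| = m} ∑_{|β| = n} u_α v_β M_{αβ}`. -/
def contractGPT (lam : ℝ) (D : Set ℂ) (m n : ℕ) (u v : ℕ × ℕ → ℝ) : ℂ :=
  ∑ α ∈ Finset.HasAntidiagonal.antidiagonal m, ∑ β ∈ Finset.HasAntidiagonal.antidiagonal n, (u α : ℂ) * (v β : ℂ) * gpt lam D α β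

/-- The contracted GPT `M^{cc}_{mn}`. -/
def cgptCC (lam : ℝ) (D : Set ℂ) (m n : ℕ) : ℂ := contractGPT lam D m n (coeffA m) (coeffA n)

/-- The contracted GPT `M^{cs}_{mn}`. -/
def cgptCS (lam : ℝ) (D : Set ℂ) (m n : ℕ) : ℂ := contractGPT lam D m n (coeffA m) (coeffB n)

/-- The contracted GPT `M^{sc}_{mn}`. -/
def cgptSC (lam : ℝ) (D : Set ℂ) (m n : ℕ) : ℂ := contractGPT lam D m n (coeffB m) (coeffA n)

/-- The contracted GPT `M^{ss}_{mn}`. -/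
def cgptSS (lam : ℝ) (D : Set ℂ) (m n : ℕ) : ℂ := contractGPT lam D m n (coeffB m) (coeffB n)

/-- The complex contracted GPT `N^{(1)}_{mn}(lam, D)`. -/
def complexCGPT1 (lam : ℝ) (D : Set ℂ) (m n : ℕ) : ℂ :=
  (cgptCC lam D m n - cgptSS lam D m n) + Complex.I * (cgptCS lam D m n + cgptSC lam D m n)

/-- The complex contracted GPT `N^{(2)}_{mn}(lam, D)`. -/
def complexCGPT2 (lam : ℝ) (D : Set ℂ) (m n : ℕ) : ℂ :=
  (cgptCC lam D m n + cgptSS lam D m n) + Complex.I * (cgptCS lam D m n - cgptSC lam D m n)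

/-- The shifted set `T_z D`. -/
def shiftSet (z : ℂ) (D : Set ℂ) : Set ℂ := (fun x => x + z) '' D

/-- The rotated set `R_θ D`. -/
def rotateSet (θ : ℝ) (D : Set ℂ) : Set ℂ := (fun x => Complex.exp (Complex.I * θ) * x) '' D

/-- The scaled set `s D`. -/
def scaleSet (s : ℝ) (D : Set ℂ) : Set ℂ := (fun x => (s : ℂ) * x) '' D

/-- The entries `C^z_{mn} = binom(m, n) z^{m-n}` of the lower triangular matrix `C^z`
(for `n > m` the binomial coefficient, hence the entry, is zero). -/
def shiftMatrix (z : ℂ) (m n : ℕ) : ℂ := (m.choose n : ℂ) * z ^ (m - n)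

/-- The contrast `(κ + 1) / (2 (κ - 1))` of an inclusion of conductivity `κ`. -/
def contrast (κ : ℝ) : ℝ := (κ + 1) / (2 * (κ - 1))

end

/-!
Each of the three transformations is a similarity `T x = a x + b` of the plane, and the quantities
on both sides are values of one bilinear form,
`polarForm lam D f h = ∫_{∂D} h (lam I - 𝒦_D^*)⁻¹[∂f/∂ν] ds`: by the definition of the coefficients
`a^m_α`, `b^m_α`, the tensor `N⁽¹⁾_{mn}(D)` is its value on `(x ^ m, x ^ n)` and `N⁽²⁾_{mn}(D)` its
value on `(conj (x ^ m), x ^ n)`.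

A similarity multiplies the arc length by `|a|` and the normal derivative by `|a|⁻¹`, and it leaves
`𝒦_D^*` unchanged, since the kernel is homogeneous of degree `-1`. Hence
`polarForm lam (T D) f h = polarForm lam D (f ∘ T) (h ∘ T)` (`polarForm_planeSim_image`). The
equation `(lam I - 𝒦_D^*) φ = g` is transported by `T` in both directions, so this needs no
solvability theory. With bilinearity (`polarForm_sum_sum`) the laws for rotations and dilations
follow from `(a x) ^ m = a ^ m x ^ m`, and the law for translations from the binomial theorem,
provided that the terms with a constant argument vanish.

A constant in the first argument has normal derivative zero. A constant in the second argument
leads to the mean of `φ = (lam I - 𝒦_D^*)⁻¹[∂f/∂ν]`. Integrating `(lam I - 𝒦_D^*) φ = ∂f/∂ν` over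
the boundary and using `𝒦_D[1] = 1 / 2` gives `(lam - 1 / 2) ∫ φ = ∫ ∂f/∂ν`, whose right-hand side
is zero for `f = x ^ l` and its conjugate by Cauchy's theorem; and `lam ≠ 1 / 2`
(`integral_inverseNP_eq_zero`).

Bilinearity, Fubini's theorem for `𝒦_D^*`, Cauchy's theorem and `𝒦_D[1] = 1 / 2` rest on the
geometry of a `C²` boundary. The Hausdorff measure of a graph is its arc length
(`comap_graphMap_hausdorffMeasure`); the boundary therefore has finite length, the kernel
`⟨x - y, ν_x⟩ / |x - y|²` is bounded by Taylor's formula, and the divergence theorem holds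
(`setIntegral_fderiv_eq_integral_bdry`, by straightening the boundary and a partition of unity).
For `𝒦_D[1] = 1 / 2` the divergence theorem is applied to the smooth field
`(x - y) / (|x - y|² + ε²)`, whose divergence `2 ε² / (|x - y|² + ε²)²` has total mass `2π`; seen at
scale `ε` from the boundary point `y`, the domain becomes a half-plane as `ε → 0` and collects half
of that mass.
-/

noncomputable section

/-! ### Arc length on a graph -/

/-- The parametrization `t ↦ t + i γ(t)` of the graph of `γ`. -/
def graphMap (γ : ℝ → ℝ) (t : ℝ) : ℂ := ⟨t, γ t⟩

/-- The length element `√(1 + γ'²)` of the graph of `γ`. -/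
def graphSpeed (γ : ℝ → ℝ) (t : ℝ) : ℝ := √(1 + deriv γ t ^ 2)

theorem one_le_graphSpeed (γ : ℝ → ℝ) (t : ℝ) : 1 ≤ graphSpeed γ t :=
  Real.one_le_sqrt.2 (by nlinarith [sq_nonneg (deriv γ t)])

theorem graphSpeed_pos (γ : ℝ → ℝ) (t : ℝ) : 0 < graphSpeed γ t :=
  zero_lt_one.trans_le (one_le_graphSpeed γ t)

theorem continuous_graphSpeed {γ : ℝ → ℝ} (hγ : ContDiff ℝ 1 γ) : Continuous (graphSpeed γ) := by
  have := hγ.continuous_deriv le_rfl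
  unfold graphSpeed
  fun_prop

theorem continuous_graphMap {γ : ℝ → ℝ} (hγ : Continuous γ) : Continuous (graphMap γ) := by
  have : graphMap γ = fun t : ℝ => (t : ℂ) + (γ t : ℂ) * Complex.I := by
    ext t
    rw [← Complex.mk_eq_add_mul_I]; rfl
  rw [this]
  fun_prop

theorem measurableEmbedding_graphMap {γ : ℝ → ℝ} (hγ : Continuous γ) :
    MeasurableEmbedding (graphMap γ) := by
  have : Topology.IsClosedEmbedding (graphMap γ) :=
    Function.LeftInverse.isClosedEmbedding (f := Complex.re) (fun t => rfl)
      Complex.continuous_re (continuous_graphMap hγ)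
  exact this.measurableEmbedding

/-- A local comparison of two measures is a global one. -/
theorem measure_le_of_locally_le {X : Type*} [TopologicalSpace X] [SecondCountableTopology X]
    [MeasurableSpace X] [OpensMeasurableSpace X] {μ ν : Measure X}
    (h : ∀ x, ∃ U : Set X, IsOpen U ∧ x ∈ U ∧ ∀ A ⊆ U, MeasurableSet A → μ A ≤ ν A) : μ ≤ ν := by
  choose U hU hxU hle using h
  obtain ⟨s, hs, hcov⟩ := TopologicalSpace.countable_cover_nhds
    (fun x => (hU x).mem_nhds (hxU x))
  refine Measure.le_iff.2 fun A hA => ?_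
  rcases s.eq_empty_or_nonempty with rfl | hne
  · have : A = ∅ := by
      have h0 : (Set.univ : Set X) = ∅ := by simpa using hcov.symm
      exact Set.subset_eq_empty (Set.subset_univ A) h0
    simp [this]
  obtain ⟨e, rfl⟩ := hs.exists_eq_range hne
  have hV : ∀ k, MeasurableSet (disjointed (fun k => U (e k)) k ∩ A) := fun k =>
    (MeasurableSet.disjointed (fun k => (hU (e k)).measurableSet) k).inter hA
  have hdisj : Pairwise (Function.onFun Disjoint
      fun k => disjointed (fun k => U (e k)) k ∩ A) := fun i j hij =>
    (disjoint_disjointed _ hij).mono Set.inter_subset_left Set.inter_subset_left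
  have hA' : A = ⋃ k, disjointed (fun k => U (e k)) k ∩ A := by
    rw [← Set.iUnion_inter, iUnion_disjointed]
    rw [Set.biUnion_range] at hcov
    rw [hcov, Set.univ_inter]
  rw [hA', measure_iUnion hdisj hV, measure_iUnion hdisj hV]
  exact ENNReal.tsum_le_tsum fun k => hle (e k) _
    (Set.inter_subset_left.trans (disjointed_subset _ k)) (hV k)

/-- The length element is a `1`-Lipschitz function of the slope. -/
theorem abs_sqrt_one_add_sq_sub_le (a b : ℝ) : |√(1 + a ^ 2) - √(1 + b ^ 2)| ≤ |a - b| := by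
  have h := abs_norm_sub_norm_le (⟨1, a⟩ : ℂ) ⟨1, b⟩
  have e : ∀ x : ℝ, ‖(⟨1, x⟩ : ℂ)‖ = √(1 + x ^ 2) := fun x => by
    rw [Complex.norm_def, Complex.normSq_mk]; ring_nf
  rw [e, e] at h
  refine h.trans (le_of_eq ?_)
  have : (⟨1, a⟩ : ℂ) - ⟨1, b⟩ = ((a - b : ℝ) : ℂ) * Complex.I := by
    apply Complex.ext <;> simp
  rw [this, norm_mul, Complex.norm_I, mul_one, Complex.norm_real, Real.norm_eq_abs]

/-- Where the slope of `γ` is within `δ` of `a`, the graph is almost a dilation by `√(1 + a²)`. -/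
theorem abs_dist_graphMap_sub_le {γ : ℝ → ℝ} (hγ : Differentiable ℝ γ) {J : Set ℝ}
    (hJ : Convex ℝ J) {a δ : ℝ} (hδ : ∀ t ∈ J, |deriv γ t - a| ≤ δ) {s t : ℝ}
    (hs : s ∈ J) (ht : t ∈ J) :
    |dist (graphMap γ s) (graphMap γ t) - √(1 + a ^ 2) * dist s t| ≤
      δ * dist s t := by
  have hmv : ‖(γ s - a * s) - (γ t - a * t)‖ ≤ δ * ‖s - t‖ := by
    refine hJ.norm_image_sub_le_of_norm_hasDerivWithin_le (f := fun t => γ t - a * t)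
      (f' := fun t => deriv γ t - a) (fun x hx => ?_) (fun x hx => ?_) ht hs
    · have h2 : HasDerivAt (fun t : ℝ => γ t - a * t) (deriv γ x - a * 1) x :=
        (hγ x).hasDerivAt.sub ((hasDerivAt_id x).const_mul a)
      rw [mul_one] at h2
      exact h2.hasDerivWithinAt
    · exact hδ x hx
  have e1 : √(1 + a ^ 2) * dist s t = ‖((s - t : ℝ) : ℂ) * ⟨1, a⟩‖ := by
    rw [norm_mul, Complex.norm_def ⟨1, a⟩, Complex.normSq_mk, Complex.norm_real,
      Real.norm_eq_abs, mul_comm, Real.dist_eq]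
    ring_nf
  rw [e1, dist_eq_norm]
  refine (abs_norm_sub_norm_le _ _).trans ?_
  have e2 : graphMap γ s - graphMap γ t - ((s - t : ℝ) : ℂ) * ⟨1, a⟩ =
      (((γ s - a * s) - (γ t - a * t) : ℝ) : ℂ) * Complex.I := by
    apply Complex.ext <;> simp [graphMap]
    ring
  rw [e2, norm_mul, Complex.norm_I, mul_one, Complex.norm_real]
  exact hmv

theorem hausdorffMeasure_graphMap_image_le {γ : ℝ → ℝ} (hγ : Differentiable ℝ γ) {J : Set ℝ}
    (hJ : Convex ℝ J) {a δ : ℝ} (hδ0 : 0 < δ) (hδ : ∀ t ∈ J, |deriv γ t - a| ≤ δ)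
    {A : Set ℝ} (hA : A ⊆ J) :
    μH[1] (graphMap γ '' A) ≤ ENNReal.ofReal (√(1 + a ^ 2) + δ) * volume A := by
  have hlip : LipschitzOnWith (Real.toNNReal (√(1 + a ^ 2) + δ)) (graphMap γ) A := by
    refine LipschitzOnWith.of_dist_le_mul fun s hs t ht => ?_
    have := (abs_le.1 (abs_dist_graphMap_sub_le hγ hJ hδ (hA hs) (hA ht))).2
    rw [Real.coe_toNNReal _ (by positivity)]
    linarith
  have := hlip.hausdorffMeasure_image_le zero_le_one
  rwa [ENNReal.rpow_one, hausdorffMeasure_real] at this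

theorem le_hausdorffMeasure_graphMap_image {γ : ℝ → ℝ} (hγ : Differentiable ℝ γ) {J : Set ℝ}
    (hJ : Convex ℝ J) {a δ : ℝ} (hδ1 : δ < 1) (hδ : ∀ t ∈ J, |deriv γ t - a| ≤ δ)
    {A : Set ℝ} (hA : A ⊆ J) :
    ENNReal.ofReal (√(1 + a ^ 2) - δ) * volume A ≤ μH[1] (graphMap γ '' A) := by
  have hL : 1 ≤ √(1 + a ^ 2) := Real.one_le_sqrt.2 (by nlinarith [sq_nonneg a])
  have hpos : 0 < √(1 + a ^ 2) - δ := by linarith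
  have hlip : LipschitzOnWith (Real.toNNReal (√(1 + a ^ 2) - δ)⁻¹) Complex.re
      (graphMap γ '' A) := by
    refine LipschitzOnWith.of_dist_le_mul ?_
    rintro _ ⟨s, hs, rfl⟩ _ ⟨t, ht, rfl⟩
    have := (abs_le.1 (abs_dist_graphMap_sub_le hγ hJ hδ (hA hs) (hA ht))).1
    rw [Real.coe_toNNReal _ (by positivity), inv_mul_eq_div, le_div_iff₀ hpos]
    change dist s t * _ ≤ _
    linarith
  have := hlip.hausdorffMeasure_image_le zero_le_one
  have himg : Complex.re '' (graphMap γ '' A) = A := by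
    rw [← Set.image_comp]
    have : Complex.re ∘ graphMap γ = id := rfl
    rw [this, Set.image_id]
  rw [ENNReal.rpow_one, hausdorffMeasure_real, himg] at this
  calc _ ≤ ENNReal.ofReal (√(1 + a ^ 2) - δ) *
        (ENNReal.ofReal (√(1 + a ^ 2) - δ)⁻¹ * μH[1] (graphMap γ '' A)) := by gcongr; exact this
    _ = _ := by
      rw [← mul_assoc, ← ENNReal.ofReal_mul hpos.le, mul_inv_cancel₀ hpos.ne', ENNReal.ofReal_one,
        one_mul]

/-- On the graph of a `C¹` function, the one-dimensional Hausdorff measure is the arc length. -/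
theorem comap_graphMap_hausdorffMeasure {γ : ℝ → ℝ} (hγ : ContDiff ℝ 1 γ) :
    (μH[1] : Measure ℂ).comap (graphMap γ) =
      volume.withDensity (fun t => ENNReal.ofReal (graphSpeed γ t)) := by
  set ρ := (μH[1] : Measure ℂ).comap (graphMap γ)
  set σ := (volume : Measure ℝ).withDensity (fun t => ENNReal.ofReal (graphSpeed γ t))
  have hd : Differentiable ℝ γ := hγ.differentiable one_ne_zero
  have hc : Continuous (deriv γ) := hγ.continuous_deriv le_rfl
  have hemb := measurableEmbedding_graphMap hγ.continuous
  set q : ℝ → ENNReal := fun δ => ENNReal.ofReal ((1 + δ) / (1 - δ))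
  have hq : Tendsto q (𝓝[>] 0) (𝓝 1) := by
    have : ContinuousAt (fun δ : ℝ => (1 + δ) / (1 - δ)) 0 :=
      ContinuousAt.div (by fun_prop) (by fun_prop) (by norm_num)
    have h2 := (ENNReal.continuous_ofReal.tendsto _).comp this.tendsto
    simp only [add_zero, sub_zero, div_one, ENNReal.ofReal_one] at h2
    exact h2.mono_left nhdsWithin_le_nhds
  -- where the slope varies by at most `δ`, the two measures agree up to the factor `q δ`
  have key : ∀ δ : ℝ, 0 < δ → δ < 1 → ∀ x : ℝ, ∃ U : Set ℝ, IsOpen U ∧ x ∈ U ∧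
      ∀ A ⊆ U, MeasurableSet A → ρ A ≤ q δ * σ A ∧ σ A ≤ q δ * ρ A := by
    intro δ h0 h1 x
    obtain ⟨r, hr, hball⟩ := Metric.continuous_iff.1 hc x δ h0
    refine ⟨Metric.ball x r, Metric.isOpen_ball, Metric.mem_ball_self hr, fun A hA hAm => ?_⟩
    have hJ := convex_ball x r
    have hδ : ∀ t ∈ Metric.ball x r, |deriv γ t - deriv γ x| ≤ δ := fun t ht =>
      (hball t ht).le
    have hL : 1 ≤ √(1 + deriv γ x ^ 2) := one_le_graphSpeed γ x
    have hsp : ∀ t ∈ A, |graphSpeed γ t - √(1 + deriv γ x ^ 2)| ≤ δ := fun t ht =>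
      (abs_sqrt_one_add_sq_sub_le _ _).trans (hδ t (hA ht))
    have hρ : ρ A = μH[1] (graphMap γ '' A) := hemb.comap_apply _ _
    have hσ : σ A = ∫⁻ t in A, ENNReal.ofReal (graphSpeed γ t) := withDensity_apply _ hAm
    set l := √(1 + deriv γ x ^ 2)
    have hσ1 : σ A ≤ ENNReal.ofReal (l + δ) * volume A := by
      rw [hσ, ← setLIntegral_const]
      refine setLIntegral_mono' hAm fun t ht => ENNReal.ofReal_le_ofReal ?_
      linarith [(abs_le.1 (hsp t ht)).2]
    have hσ2 : ENNReal.ofReal (l - δ) * volume A ≤ σ A := by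
      rw [hσ, ← setLIntegral_const]
      refine setLIntegral_mono' hAm fun t ht => ENNReal.ofReal_le_ofReal ?_
      linarith [(abs_le.1 (hsp t ht)).1]
    have hρ1 := hausdorffMeasure_graphMap_image_le hd hJ h0 hδ hA
    have hρ2 := le_hausdorffMeasure_graphMap_image hd hJ h1 hδ hA
    rw [← hρ] at hρ1 hρ2
    have hfac : ENNReal.ofReal (l + δ) ≤ q δ * ENNReal.ofReal (l - δ) := by
      have h3 : 0 < 1 - δ := by linarith
      rw [← ENNReal.ofReal_mul (by positivity)]
      apply ENNReal.ofReal_le_ofReal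
      rw [div_mul_eq_mul_div, le_div_iff₀ h3]
      nlinarith
    have hmul : ∀ X : ENNReal, ENNReal.ofReal (l - δ) * volume A ≤ X →
        ENNReal.ofReal (l + δ) * volume A ≤ q δ * X := fun X hX =>
      calc _ ≤ q δ * ENNReal.ofReal (l - δ) * volume A := by gcongr
        _ = q δ * (ENNReal.ofReal (l - δ) * volume A) := mul_assoc _ _ _
        _ ≤ _ := by gcongr
    exact ⟨hρ1.trans (hmul _ hσ2), hσ1.trans (hmul _ hρ2)⟩
  have lim : ∀ x y : ENNReal, (∀ δ : ℝ, 0 < δ → δ < 1 → x ≤ q δ * y) → x ≤ y := by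
    intro x y h
    have h2 : Tendsto (fun δ => q δ * y) (𝓝[>] 0) (𝓝 (1 * y)) :=
      ENNReal.Tendsto.mul_const hq (Or.inl one_ne_zero)
    rw [one_mul] at h2
    refine ge_of_tendsto h2 ?_
    filter_upwards [Ioo_mem_nhdsGT zero_lt_one] with δ hδ using h δ hδ.1 hδ.2
  refine le_antisymm (Measure.le_iff.2 fun A hA => lim _ _ fun δ h0 h1 => ?_)
    (Measure.le_iff.2 fun A hA => lim _ _ fun δ h0 h1 => ?_)
  · have : ρ ≤ q δ • σ := measure_le_of_locally_le fun x => by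
      obtain ⟨U, hU, hxU, h⟩ := key δ h0 h1 x
      exact ⟨U, hU, hxU, fun A hA hAm => by simpa using (h A hA hAm).1⟩
    simpa using this A
  · have : σ ≤ q δ • ρ := measure_le_of_locally_le fun x => by
      obtain ⟨U, hU, hxU, h⟩ := key δ h0 h1 x
      exact ⟨U, hU, hxU, fun A hA hAm => by simpa using (h A hA hAm).2⟩
    simpa using this A

/-- Integration over the graph of a `C¹` function with respect to the arc length. -/
theorem setIntegral_range_graphMap {γ : ℝ → ℝ} (hγ : ContDiff ℝ 1 γ) (f : ℂ → ℝ) :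
    ∫ y in Set.range (graphMap γ), f y ∂(μH[1] : Measure ℂ) =
      ∫ t, graphSpeed γ t * f (graphMap γ t) := by
  have hemb := measurableEmbedding_graphMap hγ.continuous
  rw [← hemb.map_comap, hemb.integral_map, comap_graphMap_hausdorffMeasure hγ,
    integral_withDensity_eq_integral_toReal_smul]
  · refine integral_congr_ae (ae_of_all _ fun t => ?_)
    simp only [smul_eq_mul, ENNReal.toReal_ofReal (graphSpeed_pos γ t).le]
  · exact (continuous_graphSpeed hγ).measurable.ennreal_ofReal
  · exact ae_of_all _ fun t => ENNReal.ofReal_lt_top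

/-- A bounded piece of the graph of a `C¹` function has finite length. -/
theorem hausdorffMeasure_graphMap_image_lt_top {γ : ℝ → ℝ} (hγ : ContDiff ℝ 1 γ) {A : Set ℝ}
    (hA : IsCompact A) : μH[1] (graphMap γ '' A) < ⊤ := by
  have hemb := measurableEmbedding_graphMap hγ.continuous
  rw [← hemb.comap_apply, comap_graphMap_hausdorffMeasure hγ,
    withDensity_apply _ hA.measurableSet]
  exact ((continuous_graphSpeed hγ).continuousOn.integrableOn_compact hA).setLIntegral_lt_top

/-! ### Transport by a similarity of the plane -/

/-- The orientation preserving similarity `x ↦ a x + b` of the plane. -/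
def planeSim (a b : ℂ) (ha : a ≠ 0) : ℂ ≃ₜ ℂ :=
  (Homeomorph.mulLeft₀ a ha).trans (Homeomorph.addRight b)

@[simp] theorem planeSim_apply (a b : ℂ) (ha : a ≠ 0) (x : ℂ) : planeSim a b ha x = a * x + b := rfl

theorem planeSim_symm (a b : ℂ) (ha : a ≠ 0) :
    (planeSim a b ha).symm = planeSim a⁻¹ (-(a⁻¹ * b)) (inv_ne_zero ha) := by
  ext x
  rw [Homeomorph.symm_apply_eq]
  simp only [planeSim_apply]
  field_simp
  ring

section Similarity

variable {a b : ℂ} (ha : a ≠ 0) (D : Set ℂ)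

open scoped Pointwise in
theorem hausdorffMeasure_planeSim_image (s : Set ℂ) :
    μH[1] (planeSim a b ha '' s) = ‖a‖₊ • (μH[1] : Measure ℂ) s := by
  have h : planeSim a b ha '' s = (IsometryEquiv.addRight b) '' (a • s) := by
    rw [← Set.image_smul, ← Set.image_comp]; rfl
  rw [h, (IsometryEquiv.addRight b).hausdorffMeasure_image,
    Measure.hausdorffMeasure_smul₀ zero_le_one ha, NNReal.rpow_one]

theorem bdryMeasure_planeSim_image :
    bdryMeasure (planeSim a b ha '' D) = ‖a‖₊ • (bdryMeasure D).map (planeSim a b ha) := by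
  ext s hs
  have hm : Measurable (planeSim a b ha) := (planeSim a b ha).continuous.measurable
  have himg : s ∩ planeSim a b ha '' frontier D =
      planeSim a b ha '' (planeSim a b ha ⁻¹' s ∩ frontier D) := by
    rw [Set.image_preimage_inter]
  rw [bdryMeasure, ← Homeomorph.image_frontier, Measure.restrict_apply hs, himg,
    hausdorffMeasure_planeSim_image, Measure.smul_apply, Measure.map_apply hm hs, bdryMeasure,
    Measure.restrict_apply (hm hs)]

theorem ae_bdryMeasure_planeSim_image {P : ℂ → Prop} :
    (∀ᵐ y ∂(bdryMeasure (planeSim a b ha '' D)), P y) ↔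
      ∀ᵐ x ∂(bdryMeasure D), P (planeSim a b ha x) := by
  rw [bdryMeasure_planeSim_image, Measure.ae_smul_measure_iff (nnnorm_ne_zero_iff.2 ha)]
  exact (planeSim a b ha).measurableEmbedding.ae_map_iff

theorem integral_bdryMeasure_planeSim_image (f : ℂ → ℂ) :
    ∫ y, f y ∂(bdryMeasure (planeSim a b ha '' D)) =
      ‖a‖ * ∫ x, f (planeSim a b ha x) ∂(bdryMeasure D) := by
  rw [bdryMeasure_planeSim_image, integral_smul_nnreal_measure,
    (planeSim a b ha).measurableEmbedding.integral_map, NNReal.smul_def, coe_nnnorm,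
    Complex.real_smul]

theorem memLp_bdryMeasure_planeSim_image {f : ℂ → ℂ} :
    MemLp f 2 (bdryMeasure (planeSim a b ha '' D)) ↔
      MemLp (f ∘ planeSim a b ha) 2 (bdryMeasure D) := by
  rw [bdryMeasure_planeSim_image, ← (planeSim a b ha).measurableEmbedding.memLp_map_measure_iff]
  have hne : ‖a‖₊ ≠ 0 := nnnorm_ne_zero_iff.2 ha
  refine ⟨fun h => ?_, fun h => h.smul_measure (c := (‖a‖₊ : ENNReal)) ENNReal.coe_ne_top⟩
  have := h.smul_measure (c := ((‖a‖₊⁻¹ : NNReal) : ENNReal)) ENNReal.coe_ne_top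
  rwa [← ENNReal.smul_def, smul_smul, inv_mul_cancel₀ hne, one_smul] at this

theorem inner_mul_left_mul_left (c x y : ℂ) : ⟪c * x, c * y⟫_ℝ = ‖c‖ ^ 2 * ⟪x, y⟫_ℝ := by
  rw [Complex.inner, Complex.inner, ← Complex.normSq_eq_norm_sq, Complex.normSq_apply]
  simp only [Complex.mul_re, Complex.mul_im, Complex.conj_re, Complex.conj_im]
  ring

theorem inner_mul_left_mul_div_norm (x y : ℂ) :
    ⟪a * x, a / ‖a‖ * y⟫_ℝ = ‖a‖ * ⟪x, y⟫_ℝ := by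
  rcases eq_or_ne a 0 with rfl | ha
  · simp
  have hn : ‖a‖ ≠ 0 := norm_ne_zero_iff.2 ha
  have : a / ‖a‖ * y = ‖a‖⁻¹ • (a * y) := by
    rw [Complex.real_smul]; push_cast; ring
  rw [this, real_inner_smul_right, inner_mul_left_mul_left]
  field_simp

theorem IsOuterUnitNormal.planeSim_image {D : Set ℂ} {p ν : ℂ} (h : IsOuterUnitNormal D p ν) :
    IsOuterUnitNormal (planeSim a b ha '' D) (planeSim a b ha p) (a / ‖a‖ * ν) := by
  have hn : 0 < ‖a‖ := norm_pos_iff.2 ha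
  refine ⟨by simp [h.1, hn.ne'], fun ε hε => ?_⟩
  rw [← (planeSim a b ha).map_nhds_eq, eventually_map]
  filter_upwards [h.2 ε hε] with y hy
  have hsub : planeSim a b ha y - planeSim a b ha p = a * (y - p) := by
    simp only [planeSim_apply]; ring
  rw [(planeSim a b ha).injective.mem_set_image, hsub, inner_mul_left_mul_div_norm, norm_mul,
    mul_left_comm, ← mul_neg, mul_lt_mul_iff_right₀ hn, mul_lt_mul_iff_right₀ hn]
  exact hy

theorem IsOuterUnitNormal.outerNormal_eq {D : Set ℂ} {p ν : ℂ} (h : IsOuterUnitNormal D p ν) :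
    outerNormal D p = ν := by
  have hex : ∃ ν, IsOuterUnitNormal D p ν := ⟨ν, h⟩
  rw [outerNormal, dif_pos hex]
  exact hex.choose_spec.unique h

theorem symm_image_planeSim_image :
    planeSim a⁻¹ (-(a⁻¹ * b)) (inv_ne_zero ha) '' (planeSim a b ha '' D) = D := by
  rw [← planeSim_symm a b ha, ← Set.image_comp]
  simp

/-- The equation also holds at points without normal vector, where both sides are zero. -/
theorem outerNormal_planeSim_image (p : ℂ) :
    outerNormal (planeSim a b ha '' D) (planeSim a b ha p) = a / ‖a‖ * outerNormal D p := by
  by_cases h : ∃ ν, IsOuterUnitNormal D p ν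
  · obtain ⟨ν, hν⟩ := h
    rw [hν.outerNormal_eq, (hν.planeSim_image ha).outerNormal_eq]
  · have h' : ¬ ∃ ν, IsOuterUnitNormal (planeSim a b ha '' D) (planeSim a b ha p) ν := by
      rintro ⟨ν, hν⟩
      have h2 := hν.planeSim_image (b := -(a⁻¹ * b)) (inv_ne_zero ha)
      rw [symm_image_planeSim_image, ← planeSim_symm a b ha, Homeomorph.symm_apply_apply] at h2
      exact h ⟨_, h2⟩
    rw [outerNormal, outerNormal, dif_neg h, dif_neg h', mul_zero]

/-- The operator `𝒦_D^*` is invariant under similarities: the dilation of the arc length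
compensates the homogeneity of degree `-1` of the kernel. -/
theorem npAdjoint_planeSim_image (φ : ℂ → ℂ) (x : ℂ) :
    npAdjoint (planeSim a b ha '' D) φ (planeSim a b ha x) =
      npAdjoint D (φ ∘ planeSim a b ha) x := by
  have hn : ‖a‖ ≠ 0 := norm_ne_zero_iff.2 ha
  rw [npAdjoint, npAdjoint, integral_bdryMeasure_planeSim_image, ← integral_const_mul]
  congr 2
  ext y
  have hsub : planeSim a b ha x - planeSim a b ha y = a * (x - y) := by
    simp only [planeSim_apply]; ring
  rw [outerNormal_planeSim_image, hsub, inner_mul_left_mul_div_norm, norm_mul, ← mul_assoc,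
    ← Complex.ofReal_mul, Function.comp_apply]
  congr 2
  -- for `x = y` both kernels take the value `0`
  rcases eq_or_ne (‖x - y‖) 0 with h | h
  · simp [h]
  · field_simp

theorem npAdjoint_congr_ae {D : Set ℂ} {φ ψ : ℂ → ℂ} (h : φ =ᵐ[bdryMeasure D] ψ) (x : ℂ) :
    npAdjoint D φ x = npAdjoint D ψ x := by
  rw [npAdjoint, npAdjoint]
  congr 1
  refine integral_congr_ae ?_
  filter_upwards [h] with y hy
  rw [hy]

/-- Composition with a similarity, as a map from `L²` of the image curve. -/
def pullL2 (φ : BdryL2 (planeSim a b ha '' D)) : BdryL2 D :=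
  ((memLp_bdryMeasure_planeSim_image ha D).1 (Lp.memLp φ)).toLp

theorem coeFn_pullL2 (φ : BdryL2 (planeSim a b ha '' D)) :
    pullL2 ha D φ =ᵐ[bdryMeasure D] φ ∘ planeSim a b ha := MemLp.coeFn_toLp _

theorem pullL2_bijective : Function.Bijective (pullL2 (b := b) ha D) := by
  constructor
  · intro φ ψ h
    apply Lp.ext
    refine (ae_bdryMeasure_planeSim_image ha D).2 ?_
    have h1 := coeFn_pullL2 ha D φ
    rw [h] at h1
    filter_upwards [h1, coeFn_pullL2 ha D ψ] with x hx hx'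
    exact hx.symm.trans hx'
  · intro φ
    have hmem : MemLp (φ ∘ (planeSim a b ha).symm) 2 (bdryMeasure (planeSim a b ha '' D)) := by
      rw [memLp_bdryMeasure_planeSim_image, Function.comp_assoc]
      have : (planeSim a b ha).symm ∘ planeSim a b ha = id :=
        funext (planeSim a b ha).symm_apply_apply
      rw [this]
      exact Lp.memLp φ
    refine ⟨hmem.toLp, ?_⟩
    apply Lp.ext
    filter_upwards [coeFn_pullL2 ha D hmem.toLp,
      (ae_bdryMeasure_planeSim_image ha D).1 hmem.coeFn_toLp] with x hx hx'
    rw [hx, Function.comp_apply, hx', Function.comp_apply, Homeomorph.symm_apply_apply]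

theorem pullL2_toBdryL2 (g : ℂ → ℂ) :
    pullL2 ha D (toBdryL2 (planeSim a b ha '' D) g) = toBdryL2 D (g ∘ planeSim a b ha) := by
  by_cases h : MemLp g 2 (bdryMeasure (planeSim a b ha '' D))
  · have h' := (memLp_bdryMeasure_planeSim_image ha D).1 h
    rw [toBdryL2, toBdryL2, dif_pos h, dif_pos h']
    apply Lp.ext
    filter_upwards [coeFn_pullL2 ha D h.toLp, h'.coeFn_toLp,
      (ae_bdryMeasure_planeSim_image ha D).1 h.coeFn_toLp] with x h1 h2 h3
    rw [h1, h2, Function.comp_apply, h3, Function.comp_apply]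
  · have h' := (memLp_bdryMeasure_planeSim_image ha D).not.1 h
    rw [toBdryL2, toBdryL2, dif_neg h, dif_neg h']
    apply Lp.ext
    filter_upwards [coeFn_pullL2 ha D 0, Lp.coeFn_zero ℂ 2 (bdryMeasure D),
      (ae_bdryMeasure_planeSim_image ha D).1
        (Lp.coeFn_zero ℂ 2 (bdryMeasure (planeSim a b ha '' D)))] with x h1 h2 h3
    rw [h1, h2, Function.comp_apply, h3, Pi.zero_apply, Pi.zero_apply]

variable {D} {lam : ℝ}

theorem IsInverseNP.planeSim_image {R : BdryL2 D → BdryL2 D} (hR : IsInverseNP lam D R) :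
    IsInverseNP lam (planeSim a b ha '' D) (fun g =>
      (Equiv.ofBijective _ (pullL2_bijective (b := b) ha D)).symm (R (pullL2 ha D g))) := by
  intro φ g
  rw [Equiv.symm_apply_eq, Equiv.ofBijective_apply, hR, ae_bdryMeasure_planeSim_image]
  refine eventually_congr ?_
  filter_upwards [coeFn_pullL2 ha D φ, coeFn_pullL2 ha D g] with x h1 h2
  rw [h1, h2, npAdjoint_congr_ae (coeFn_pullL2 ha D φ), npAdjoint_planeSim_image]
  rfl

theorem IsInverseNP.inverseNP_eq {R : BdryL2 D → BdryL2 D} (hR : IsInverseNP lam D R) :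
    inverseNP lam D = R := by
  have hex : ∃ R, IsInverseNP lam D R := ⟨R, hR⟩
  rw [inverseNP, dif_pos hex]
  ext1 g
  exact ((hR _ g).2 ((hex.choose_spec _ g).1 rfl)).symm

/-- The operator `(lam I - 𝒦_D^*)⁻¹` is invariant under similarities. It exists on both sides or on
neither, so that the convention `0` for a missing inverse agrees too. -/
theorem pullL2_inverseNP (g : BdryL2 (planeSim a b ha '' D)) :
    pullL2 ha D (inverseNP lam (planeSim a b ha '' D) g) = inverseNP lam D (pullL2 ha D g) := by
  by_cases h : ∃ R, IsInverseNP lam D R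
  · obtain ⟨R, hR⟩ := h
    rw [hR.inverseNP_eq, (hR.planeSim_image ha).inverseNP_eq]
    exact (Equiv.ofBijective _ (pullL2_bijective (b := b) ha D)).apply_symm_apply _
  · have h' : ¬ ∃ R, IsInverseNP lam (planeSim a b ha '' D) R := by
      rintro ⟨R, hR⟩
      have h2 : ∃ R, IsInverseNP lam _ R :=
        ⟨_, hR.planeSim_image (b := -(a⁻¹ * b)) (inv_ne_zero ha)⟩
      rw [symm_image_planeSim_image] at h2
      exact h h2
    rw [inverseNP, inverseNP, dif_neg h, dif_neg h', Pi.zero_apply, Pi.zero_apply]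
    apply Lp.ext
    filter_upwards [coeFn_pullL2 ha D 0, Lp.coeFn_zero ℂ 2 (bdryMeasure D),
      (ae_bdryMeasure_planeSim_image ha D).1
        (Lp.coeFn_zero ℂ 2 (bdryMeasure (planeSim a b ha '' D)))] with x h1 h2 h3
    rw [h1, h2, Function.comp_apply, h3, Pi.zero_apply, Pi.zero_apply]

theorem npAdjoint_smul (c : ℂ) (φ : ℂ → ℂ) (x : ℂ) :
    npAdjoint D (c • φ) x = c * npAdjoint D φ x := by
  rw [npAdjoint, npAdjoint, mul_left_comm, ← integral_const_mul c]
  congr 1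
  refine integral_congr_ae (ae_of_all _ fun y => ?_)
  simp only [Pi.smul_apply, smul_eq_mul]
  ring

theorem inverseNP_smul (c : ℂ) (g : BdryL2 D) :
    inverseNP lam D (c • g) = c • inverseNP lam D g := by
  by_cases h : ∃ R, IsInverseNP lam D R
  · obtain ⟨R, hR⟩ := h
    rw [hR.inverseNP_eq, hR]
    filter_upwards [(hR _ g).1 rfl, Lp.coeFn_smul c g, Lp.coeFn_smul c (R g)] with x h1 h2 h3
    rw [npAdjoint_congr_ae (Lp.coeFn_smul c (R g)), npAdjoint_smul, h2, h3, Pi.smul_apply,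
      Pi.smul_apply, smul_eq_mul, smul_eq_mul, ← h1]
    ring
  · rw [inverseNP, dif_neg h, Pi.zero_apply, Pi.zero_apply, smul_zero]

theorem toBdryL2_smul {c : ℂ} (hc : c ≠ 0) (g : ℂ → ℂ) :
    toBdryL2 D (c • g) = c • toBdryL2 D g := by
  by_cases h : MemLp g 2 (bdryMeasure D)
  · rw [toBdryL2, toBdryL2, dif_pos h, dif_pos (h.const_smul c), MemLp.toLp_const_smul]
  · have h' : ¬ MemLp (c • g) 2 (bdryMeasure D) := fun h2 => h (by
      have := h2.const_smul c⁻¹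
      rwa [smul_smul, inv_mul_cancel₀ hc, one_smul] at this)
    rw [toBdryL2, toBdryL2, dif_neg h, dif_neg h', smul_zero]

/-- The bilinear form `(f, h) ↦ ∫_{∂D} h (lam I - 𝒦_D^*)⁻¹[∂f/∂ν] ds`, of which the generalized
polarization tensors are the values on pairs of monomials. -/
def polarForm (lam : ℝ) (D : Set ℂ) (f h : ℂ → ℂ) : ℂ :=
  ∫ y, h y * inverseNP lam D (toBdryL2 D (normalDeriv D f)) y ∂(bdryMeasure D)

theorem normalDeriv_planeSim_image {f : ℂ → ℂ} (hf : Differentiable ℝ f) :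
    normalDeriv (planeSim a b ha '' D) f ∘ planeSim a b ha =
      ((‖a‖⁻¹ : ℝ) : ℂ) • normalDeriv D (f ∘ planeSim a b ha) := by
  ext x
  have hT : HasFDerivAt (𝕜 := ℝ) (planeSim a b ha) (ContinuousLinearMap.mul ℝ ℂ a) x :=
    ((ContinuousLinearMap.mul ℝ ℂ a).hasFDerivAt).add_const b
  have hcomp := (hf (planeSim a b ha x)).hasFDerivAt.comp x hT
  rw [Function.comp_apply, Pi.smul_apply, normalDeriv, normalDeriv, hcomp.fderiv,
    outerNormal_planeSim_image, ContinuousLinearMap.comp_apply, ContinuousLinearMap.mul_apply',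
    smul_eq_mul, ← Complex.real_smul, ← map_smul, Complex.real_smul]
  congr 1
  push_cast
  ring

/-- A similarity acts on the form `polarForm` by composition of both arguments. -/
theorem polarForm_planeSim_image {f : ℂ → ℂ} (hf : Differentiable ℝ f) (h : ℂ → ℂ) :
    polarForm lam (planeSim a b ha '' D) f h =
      polarForm lam D (f ∘ planeSim a b ha) (h ∘ planeSim a b ha) := by
  have hn : ((‖a‖ : ℝ) : ℂ) ≠ 0 := Complex.ofReal_ne_zero.2 (norm_ne_zero_iff.2 ha)
  set g := toBdryL2 (planeSim a b ha '' D) (normalDeriv (planeSim a b ha '' D) f)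
  have hg : pullL2 ha D (inverseNP lam _ g) = (((‖a‖⁻¹ : ℝ) : ℂ)) •
      inverseNP lam D (toBdryL2 D (normalDeriv D (f ∘ planeSim a b ha))) := by
    rw [pullL2_inverseNP, pullL2_toBdryL2, normalDeriv_planeSim_image ha hf,
      toBdryL2_smul (by simpa using ha), inverseNP_smul]
  have h1 := coeFn_pullL2 ha D (inverseNP lam _ g)
  rw [hg] at h1
  rw [polarForm, integral_bdryMeasure_planeSim_image, ← integral_const_mul, polarForm]
  refine integral_congr_ae ?_
  filter_upwards [h1, Lp.coeFn_smul (((‖a‖⁻¹ : ℝ) : ℂ))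
    (inverseNP lam D (toBdryL2 D (normalDeriv D (f ∘ planeSim a b ha))))] with x hx hx'
  have : inverseNP lam _ g (planeSim a b ha x) = _ := (hx.symm.trans hx' :)
  rw [this, Pi.smul_apply, smul_eq_mul, Function.comp_apply]
  push_cast
  field_simp

end Similarity

/-! ### Boundary geometry of a `C²` domain -/

/-- In `ball p r`, and in the axes rotated by `c`, the set `D` lies strictly above the graph of the
`C²` function `γ`. This is the condition of `IsBoundedC2Domain`, but `p` need not be a boundary
point. -/
structure IsBdryChart (D : Set ℂ) (p c : ℂ) (r : ℝ) (γ : ℝ → ℝ) : Prop where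
  norm_eq_one : ‖c‖ = 1
  pos : 0 < r
  contDiff : ContDiff ℝ 2 γ
  mem_iff : ∀ x ∈ Metric.ball p r, x ∈ D ↔ γ (c * x).re < (c * x).im

theorem IsBoundedC2Domain.exists_isBdryChart {D : Set ℂ} (hD : IsBoundedC2Domain D) {p : ℂ}
    (hp : p ∈ frontier D) : ∃ c r γ, IsBdryChart D p c r γ := by
  obtain ⟨c, r, γ, h1, h2, h3, h4⟩ := hD.exists_graph p hp
  exact ⟨c, r, γ, h1, h2, h3, h4⟩

namespace IsBdryChart

variable {D : Set ℂ} {p c : ℂ} {r : ℝ} {γ : ℝ → ℝ}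

theorem conj_mul_self (h : IsBdryChart D p c r γ) : (starRingEnd ℂ) c * c = 1 := by
  rw [mul_comm, Complex.mul_conj, Complex.normSq_eq_norm_sq, h.norm_eq_one]; simp

theorem mem_frontier_iff (h : IsBdryChart D p c r γ) (hD : IsOpen D) {x : ℂ}
    (hx : x ∈ Metric.ball p r) : x ∈ frontier D ↔ (c * x).im = γ (c * x).re := by
  have hball : Metric.ball p r ∈ 𝓝 x := Metric.isOpen_ball.mem_nhds hx
  have hγ := h.contDiff.continuous
  rw [hD.frontier_eq, Set.mem_sdiff, h.mem_iff x hx, not_lt]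
  constructor
  · rintro ⟨hcl, hle⟩
    refine hle.antisymm (not_lt.1 fun hlt => ?_)
    have hopen : ∀ᶠ y in 𝓝 x, (c * y).im < γ (c * y).re :=
      (isOpen_lt (by fun_prop) (by fun_prop)).mem_nhds hlt
    obtain ⟨y, ⟨hy1, hy2⟩, hyD⟩ :=
      mem_closure_iff_nhds.1 hcl _ (Filter.inter_mem hopen hball)
    exact lt_asymm ((h.mem_iff y hy2).1 hyD) hy1
  · intro heq
    refine ⟨?_, heq.le⟩
    have hcont : Tendsto (fun t : ℝ => x + (starRingEnd ℂ) c * (t * Complex.I)) (𝓝[>] 0) (𝓝 x) := by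
      have : Tendsto (fun t : ℝ => x + (starRingEnd ℂ) c * (t * Complex.I)) (𝓝 0)
          (𝓝 (x + (starRingEnd ℂ) c * ((0 : ℝ) * Complex.I))) :=
        Continuous.tendsto (by fun_prop) 0
      simp only [Complex.ofReal_zero, zero_mul, mul_zero, add_zero] at this
      exact this.mono_left nhdsWithin_le_nhds
    refine mem_closure_of_tendsto hcont ?_
    filter_upwards [hcont.eventually hball, self_mem_nhdsWithin] with t ht ht0
    have e : c * (x + (starRingEnd ℂ) c * (t * Complex.I)) = c * x + t * Complex.I := by
      linear_combination (t * Complex.I) * h.conj_mul_self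
    rw [h.mem_iff _ ht, e]
    have ht0 : 0 < t := ht0
    simp [heq, ht0]

/-- The outward unit normal vector over the abscissa `t` of a boundary chart. -/
def normal (c : ℂ) (γ : ℝ → ℝ) (t : ℝ) : ℂ :=
  (starRingEnd ℂ) c * (⟨deriv γ t / graphSpeed γ t, -1 / graphSpeed γ t⟩ : ℂ)

theorem inner_normal (y : ℂ) (t : ℝ) : ⟪y, normal c γ t⟫_ℝ =
    (deriv γ t * (c * y).re - (c * y).im) / graphSpeed γ t := by
  have := (graphSpeed_pos γ t).ne'
  rw [normal, Complex.inner]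
  simp only [Complex.mul_re, Complex.mul_im, Complex.conj_re, Complex.conj_im]
  field_simp
  ring

theorem isOuterUnitNormal (h : IsBdryChart D p c r γ) (hD : IsOpen D) {x : ℂ}
    (hx : x ∈ Metric.ball p r) (hxD : x ∈ frontier D) :
    IsOuterUnitNormal D x (normal c γ (c * x).re) := by
  have hball : Metric.ball p r ∈ 𝓝 x := Metric.isOpen_ball.mem_nhds hx
  have hx0 := (h.mem_frontier_iff hD hx).1 hxD
  set s := (c * x).re
  have hL1 := one_le_graphSpeed γ s
  have hL0 := graphSpeed_pos γ s
  have hLsq : graphSpeed γ s ^ 2 = 1 + deriv γ s ^ 2 := Real.sq_sqrt (by positivity)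
  have hder : HasDerivAt γ (deriv γ s) s :=
    ((h.contDiff.differentiable (by norm_num)) _).hasDerivAt
  refine ⟨?_, ?_⟩
  · rw [normal, norm_mul, RCLike.norm_conj, h.norm_eq_one, one_mul, Complex.norm_def,
      Complex.normSq_mk, Real.sqrt_eq_one]
    field_simp
    linarith
  · intro ε hε
    have hlim : Tendsto (fun y : ℂ => (c * y).re) (𝓝 x) (𝓝 s) :=
      Continuous.tendsto (by fun_prop) x
    have ho := hlim.eventually ((hasDerivAt_iff_isLittleO.1 hder).def hε)
    filter_upwards [ho, hball] with y hy hyb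
    rw [inner_normal, h.mem_iff y hyb]
    have hre : (c * y).re - s = (c * (y - x)).re := by rw [mul_sub, Complex.sub_re]
    have him : (c * y).im - (c * x).im = (c * (y - x)).im := by rw [mul_sub, Complex.sub_im]
    have hu : |(c * (y - x)).re| ≤ ‖y - x‖ := by
      refine (Complex.abs_re_le_norm _).trans ?_
      rw [norm_mul, h.norm_eq_one, one_mul]
    rw [hre, smul_eq_mul, Real.norm_eq_abs, Real.norm_eq_abs] at hy
    have hy' := abs_le.1 (hy.trans (mul_le_mul_of_nonneg_left hu hε.le))
    have hεL : ε * ‖y - x‖ ≤ ε * ‖y - x‖ * graphSpeed γ s :=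
      le_mul_of_one_le_right (by positivity) hL1
    constructor
    · intro h
      rw [div_lt_iff₀ hL0] at h
      nlinarith [hy'.2]
    · intro h
      rw [lt_div_iff₀ hL0] at h
      rw [not_lt]
      nlinarith [hy'.1]

theorem outerNormal_eq (h : IsBdryChart D p c r γ) (hD : IsOpen D) {x : ℂ}
    (hx : x ∈ Metric.ball p r) (hxD : x ∈ frontier D) :
    outerNormal D x = normal c γ (c * x).re :=
  (h.isOuterUnitNormal hD hx hxD).outerNormal_eq

theorem continuous_normal (h : IsBdryChart D p c r γ) : Continuous (normal c γ) := by
  have hγ : ContDiff ℝ 1 γ := h.contDiff.of_le one_le_two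
  have h1 := continuous_graphSpeed hγ
  have h2 := hγ.continuous_deriv le_rfl
  have h3 : ∀ t, graphSpeed γ t ≠ 0 := fun t => (graphSpeed_pos γ t).ne'
  have : normal c γ = fun t => (starRingEnd ℂ) c *
      (((deriv γ t / graphSpeed γ t : ℝ) : ℂ) + ((-1 / graphSpeed γ t : ℝ) : ℂ) * Complex.I) := by
    ext t
    rw [← Complex.mk_eq_add_mul_I]; rfl
  rw [this]
  have h4 : Continuous fun t => deriv γ t / graphSpeed γ t := h2.div h1 h3
  have h5 : Continuous fun t => -1 / graphSpeed γ t := continuous_const.div h1 h3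
  exact continuous_const.mul ((Complex.continuous_ofReal.comp h4).add
    ((Complex.continuous_ofReal.comp h5).mul continuous_const))

theorem mul_eq_graphMap (h : IsBdryChart D p c r γ) (hD : IsOpen D) {x : ℂ}
    (hx : x ∈ Metric.ball p r) (hxD : x ∈ frontier D) : c * x = graphMap γ (c * x).re :=
  Complex.ext rfl ((h.mem_frontier_iff hD hx).1 hxD)

theorem abs_re_sub_le (h : IsBdryChart D p c r γ) (x y : ℂ) :
    |(c * x).re - (c * y).re| ≤ ‖x - y‖ := by
  rw [← Complex.sub_re, ← mul_sub]
  refine (Complex.abs_re_le_norm _).trans ?_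
  rw [norm_mul, h.norm_eq_one, one_mul]

theorem re_mem_Icc (h : IsBdryChart D p c r γ) {x : ℂ} (hx : x ∈ Metric.ball p r) :
    (c * x).re ∈ Set.Icc ((c * p).re - r) ((c * p).re + r) := by
  have h1 := abs_le.1 (h.abs_re_sub_le x p)
  have h2 := mem_ball_iff_norm.1 hx
  constructor <;> linarith [h1.1, h1.2]

theorem ne_zero (h : IsBdryChart D p c r γ) : c ≠ 0 :=
  norm_ne_zero_iff.1 (by rw [h.norm_eq_one]; exact one_ne_zero)

theorem hausdorffMeasure_lt_top (h : IsBdryChart D p c r γ) (hD : IsOpen D) :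
    μH[1] (Metric.ball p r ∩ frontier D) < ⊤ := by
  have h1 := hausdorffMeasure_planeSim_image (b := 0) h.ne_zero (Metric.ball p r ∩ frontier D)
  rw [show ‖c‖₊ = 1 from NNReal.eq h.norm_eq_one, one_smul] at h1
  rw [← h1]
  refine (measure_mono ?_).trans_lt (hausdorffMeasure_graphMap_image_lt_top
    (h.contDiff.of_le one_le_two) (isCompact_Icc (a := (c * p).re - r) (b := (c * p).re + r)))
  rintro _ ⟨x, ⟨hx, hxD⟩, rfl⟩
  rw [planeSim_apply, add_zero, h.mul_eq_graphMap hD hx hxD]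
  exact Set.mem_image_of_mem _ (h.re_mem_Icc hx)

/-- Taylor's formula: near a boundary point the tangent line is at quadratic distance from the
boundary. -/
theorem exists_abs_inner_le (h : IsBdryChart D p c r γ) (hD : IsOpen D) :
    ∃ C : ℝ, ∀ x ∈ Metric.ball p r ∩ frontier D, ∀ y ∈ Metric.ball p r ∩ frontier D,
      |⟪x - y, outerNormal D x⟫_ℝ| ≤ C * ‖x - y‖ ^ 2 := by
  set J := Set.Icc ((c * p).re - r) ((c * p).re + r)
  have hd1 : Differentiable ℝ γ := h.contDiff.differentiable (by norm_num)
  have hγ' : ContDiff ℝ 1 (deriv γ) := by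
    have h2 : ContDiff ℝ (1 + 1) γ := by
      have : ((1 : WithTop ℕ∞) + 1) = 2 := one_add_one_eq_two
      rw [this]; exact h.contDiff
    exact (contDiff_succ_iff_deriv.1 h2).2.2
  obtain ⟨M, hM⟩ := (isCompact_Icc (a := (c * p).re - r)
    (b := (c * p).re + r)).exists_bound_of_continuousOn (hγ'.continuous_deriv le_rfl).continuousOn
  have hlip : ∀ s ∈ J, ∀ t ∈ J, |deriv γ s - deriv γ t| ≤ M * |s - t| := fun s hs t ht =>
    (convex_Icc _ _).norm_image_sub_le_of_norm_deriv_le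
      (fun x _ => (hγ'.differentiable one_ne_zero) x) hM ht hs
  have hM0 : 0 ≤ M := (norm_nonneg _).trans (hM ((c * p).re)
    ⟨by linarith [h.pos], by linarith [h.pos]⟩)
  have htaylor : ∀ s ∈ J, ∀ t ∈ J,
      |deriv γ s * (s - t) - (γ s - γ t)| ≤ M * |s - t| * |s - t| := by
    intro s hs t ht
    have hsub : Set.uIcc s t ⊆ J := Set.uIcc_subset_Icc hs ht
    have := (convex_uIcc s t).norm_image_sub_le_of_norm_hasDerivWithin_le
      (f := fun u => deriv γ s * u - γ u) (f' := fun u => deriv γ s - deriv γ u)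
      (C := M * |s - t|) (x := t) (y := s) (fun u _ => ?_) (fun u hu => ?_)
      Set.right_mem_uIcc Set.left_mem_uIcc
    · refine (le_of_eq ?_).trans this
      rw [Real.norm_eq_abs]
      congr 1
      ring
    · have h2 : HasDerivAt (fun u => deriv γ s * u - γ u) (deriv γ s * 1 - deriv γ u) u :=
        ((hasDerivAt_id u).const_mul _).sub (hd1 u).hasDerivAt
      rw [mul_one] at h2
      exact h2.hasDerivWithinAt
    · refine (hlip s hs u (hsub hu)).trans (mul_le_mul_of_nonneg_left ?_ hM0)
      rw [abs_sub_comm s u, abs_sub_comm s t]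
      exact Set.abs_sub_left_of_mem_uIcc hu
  refine ⟨M, fun x hx y hy => ?_⟩
  have hxim := (h.mem_frontier_iff hD hx.1).1 hx.2
  have hyim := (h.mem_frontier_iff hD hy.1).1 hy.2
  rw [h.outerNormal_eq hD hx.1 hx.2, inner_normal, mul_sub, Complex.sub_re, Complex.sub_im, hxim,
    hyim, abs_div, abs_of_pos (graphSpeed_pos _ _)]
  refine (div_le_self (abs_nonneg _) (one_le_graphSpeed _ _)).trans
    ((htaylor _ (h.re_mem_Icc hx.1) _ (h.re_mem_Icc hy.1)).trans ?_)
  have := h.abs_re_sub_le x y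
  rw [sq, mul_assoc]
  gcongr

end IsBdryChart

namespace IsBoundedC2Domain

variable {D : Set ℂ}

theorem isCompact_frontier (hD : IsBoundedC2Domain D) : IsCompact (frontier D) :=
  Metric.isCompact_of_isClosed_isBounded isClosed_frontier
    (hD.isBounded.closure.subset frontier_subset_closure)

theorem isFiniteMeasure_bdryMeasure (hD : IsBoundedC2Domain D) :
    IsFiniteMeasure (bdryMeasure D) := by
  refine ⟨?_⟩
  rw [bdryMeasure, Measure.restrict_apply_univ]
  refine hD.isCompact_frontier.measure_lt_top_of_nhdsWithin fun p hp => ?_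
  obtain ⟨c, r, γ, h⟩ := hD.exists_isBdryChart hp
  exact ⟨_, inter_mem_nhdsWithin _ (Metric.ball_mem_nhds p h.pos), by
    rw [Set.inter_comm]; exact h.hausdorffMeasure_lt_top hD.isOpen⟩

theorem continuousOn_outerNormal (hD : IsBoundedC2Domain D) :
    ContinuousOn (outerNormal D) (frontier D) := by
  intro p hp
  obtain ⟨c, r, γ, h⟩ := hD.exists_isBdryChart hp
  have hcont : Continuous fun x : ℂ => IsBdryChart.normal c γ (c * x).re :=
    h.continuous_normal.comp (by fun_prop)
  refine (hcont.continuousWithinAt (s := frontier D) (x := p)).congr_of_eventuallyEq ?_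
    (h.outerNormal_eq hD.isOpen (Metric.mem_ball_self h.pos) hp)
  filter_upwards [inter_mem_nhdsWithin _ (Metric.ball_mem_nhds p h.pos)] with x hx
  exact h.outerNormal_eq hD.isOpen hx.2 hx.1

theorem norm_outerNormal (hD : IsBoundedC2Domain D) {p : ℂ} (hp : p ∈ frontier D) :
    ‖outerNormal D p‖ = 1 := by
  obtain ⟨ν, hν⟩ := hD.exists_isOuterUnitNormal hp
  rw [hν.outerNormal_eq, hν.1]

/-- The kernel of `𝒦_D^*` is bounded. -/
theorem exists_abs_inner_le (hD : IsBoundedC2Domain D) :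
    ∃ C : ℝ, ∀ x ∈ frontier D, ∀ y ∈ frontier D,
      |⟪x - y, outerNormal D x⟫_ℝ| ≤ C * ‖x - y‖ ^ 2 := by
  -- a local bound near each pair of boundary points suffices, by compactness; on the diagonal it is
  -- Taylor's formula, off the diagonal the denominator is bounded below
  suffices H : ∃ C : ℝ, ∀ q ∈ frontier D ×ˢ frontier D, q.1 ∈ frontier D → q.2 ∈ frontier D →
      |⟪q.1 - q.2, outerNormal D q.1⟫_ℝ| ≤ C * ‖q.1 - q.2‖ ^ 2 by
    obtain ⟨C, hC⟩ := H
    exact ⟨C, fun x hx y hy => hC (x, y) ⟨hx, hy⟩ hx hy⟩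
  refine (hD.isCompact_frontier.prod hD.isCompact_frontier).induction_on
    (p := fun S : Set (ℂ × ℂ) => ∃ C : ℝ, ∀ q ∈ S, q.1 ∈ frontier D → q.2 ∈ frontier D →
      |⟪q.1 - q.2, outerNormal D q.1⟫_ℝ| ≤ C * ‖q.1 - q.2‖ ^ 2) ⟨0, by simp⟩ ?_ ?_ ?_
  · rintro S T hST ⟨C, hC⟩
    exact ⟨C, fun q hq => hC q (hST hq)⟩
  · rintro S T ⟨C, hC⟩ ⟨C', hC'⟩
    refine ⟨max C C', fun q hq h1 h2 => ?_⟩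
    rcases hq with hq | hq
    · exact (hC q hq h1 h2).trans (by gcongr; exact le_max_left _ _)
    · exact (hC' q hq h1 h2).trans (by gcongr; exact le_max_right _ _)
  · rintro ⟨x, y⟩ ⟨hx, hy⟩
    by_cases hxy : x = y
    · subst hxy
      obtain ⟨c, r, γ, h⟩ := hD.exists_isBdryChart hx
      obtain ⟨C, hC⟩ := h.exists_abs_inner_le hD.isOpen
      refine ⟨Metric.ball x r ×ˢ Metric.ball x r, mem_nhdsWithin_of_mem_nhds
        (prod_mem_nhds (Metric.ball_mem_nhds x h.pos) (Metric.ball_mem_nhds x h.pos)), C, ?_⟩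
      rintro ⟨u, v⟩ ⟨hu, hv⟩ hu' hv'
      exact hC u ⟨hu, hu'⟩ v ⟨hv, hv'⟩
    · have hpos : 0 < ‖x - y‖ := norm_pos_iff.2 (sub_ne_zero.2 hxy)
      have hopen : ∀ᶠ q : ℂ × ℂ in 𝓝 (x, y), ‖x - y‖ / 2 < ‖q.1 - q.2‖ :=
        (isOpen_lt (by fun_prop) (by fun_prop)).mem_nhds (half_lt_self hpos)
      refine ⟨_, mem_nhdsWithin_of_mem_nhds hopen, 2 / ‖x - y‖, fun q hq h1 h2 => ?_⟩
      have hq : ‖x - y‖ / 2 < ‖q.1 - q.2‖ := hq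
      refine (abs_real_inner_le_norm _ _).trans ?_
      rw [hD.norm_outerNormal h1, mul_one, div_mul_eq_mul_div, le_div_iff₀ hpos]
      nlinarith [norm_nonneg (q.1 - q.2)]

theorem aestronglyMeasurable_outerNormal (hD : IsBoundedC2Domain D) :
    AEStronglyMeasurable (outerNormal D) (bdryMeasure D) :=
  hD.continuousOn_outerNormal.aestronglyMeasurable isClosed_frontier.measurableSet

end IsBoundedC2Domain

theorem ae_mem_frontier (D : Set ℂ) : ∀ᵐ x ∂(bdryMeasure D), x ∈ frontier D :=
  ae_restrict_mem isClosed_frontier.measurableSet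

/-! ### The divergence theorem -/

theorem integral_halfPlane_fderiv_fst {F : ℝ × ℝ → ℝ} (hF : ContDiff ℝ 1 F)
    (hc : HasCompactSupport F) :
    ∫ z in Set.univ ×ˢ Set.Ioi (0 : ℝ), fderiv ℝ F z (1, 0) = 0 := by
  have hcont : Continuous fun z => fderiv ℝ F z (1, 0) :=
    (hF.continuous_fderiv one_ne_zero).clm_apply continuous_const
  have hcs : HasCompactSupport fun z => fderiv ℝ F z (1, 0) := hc.fderiv_apply ℝ (1, 0)
  have hint := hcont.integrable_of_hasCompactSupport (μ := volume) hcs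
  rw [Measure.volume_eq_prod] at hint ⊢
  have hint' := hint.integrableOn (s := Set.univ ×ˢ Set.Ioi (0 : ℝ))
  rw [IntegrableOn, ← Measure.prod_restrict] at hint'
  rw [← Measure.prod_restrict, integral_prod_symm _ hint']
  refine integral_eq_zero_of_ae (ae_of_all _ fun v => ?_)
  have hemb : IsClosedEmbedding fun u : ℝ => (u, v) :=
    Function.LeftInverse.isClosedEmbedding (f := Prod.fst) (fun t => rfl) (by fun_prop)
      (by fun_prop)
  have hd : ∀ u : ℝ, HasDerivAt (fun u => F (u, v)) (fderiv ℝ F (u, v) (1, 0)) u := fun u =>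
    ((hF.differentiable one_ne_zero) (u, v)).hasFDerivAt.comp_hasDerivAt u
      ((hasDerivAt_id u).prodMk (hasDerivAt_const u v))
  rw [Measure.restrict_univ]
  refine integral_eq_zero_of_hasDerivAt_of_integrable hd ?_ ?_
  · exact (hcont.comp hemb.continuous).integrable_of_hasCompactSupport
      (hcs.comp_isClosedEmbedding hemb)
  · exact (hF.continuous.comp hemb.continuous).integrable_of_hasCompactSupport
      (hc.comp_isClosedEmbedding hemb)

theorem integral_halfPlane_mul_fderiv_snd {F : ℝ × ℝ → ℝ} (hF : ContDiff ℝ 1 F)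
    (hc : HasCompactSupport F) {k : ℝ → ℝ} (hk : Continuous k) :
    ∫ z in Set.univ ×ˢ Set.Ioi (0 : ℝ), k z.1 * fderiv ℝ F z (0, 1) =
      -∫ u, k u * F (u, 0) := by
  have hcont : Continuous fun z => fderiv ℝ F z (0, 1) :=
    (hF.continuous_fderiv one_ne_zero).clm_apply continuous_const
  have hcs : HasCompactSupport fun z => fderiv ℝ F z (0, 1) := hc.fderiv_apply ℝ (0, 1)
  have hint : Integrable (fun z => k z.1 * fderiv ℝ F z (0, 1)) volume :=
    ((hk.comp continuous_fst).mul hcont).integrable_of_hasCompactSupport hcs.mul_left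
  rw [Measure.volume_eq_prod] at hint ⊢
  have hint' := hint.integrableOn (s := Set.univ ×ˢ Set.Ioi (0 : ℝ))
  rw [setIntegral_prod _ hint', Measure.restrict_univ, ← integral_neg]
  refine integral_congr_ae (ae_of_all _ fun u => ?_)
  have hemb : IsClosedEmbedding fun v : ℝ => (u, v) :=
    Function.LeftInverse.isClosedEmbedding (f := Prod.snd) (fun t => rfl) (by fun_prop)
      (by fun_prop)
  have hd : ∀ v : ℝ, HasDerivAt (fun v => F (u, v)) (fderiv ℝ F (u, v) (0, 1)) v := fun v =>
    ((hF.differentiable one_ne_zero) (u, v)).hasFDerivAt.comp_hasDerivAt v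
      ((hasDerivAt_const v u).prodMk (hasDerivAt_id v))
  have h1 : ContDiff ℝ 1 fun v => F (u, v) := hF.comp (contDiff_const.prodMk contDiff_id)
  have h2 : HasCompactSupport fun v => F (u, v) := hc.comp_isClosedEmbedding hemb
  have h3 := h2.integral_Ioi_deriv_eq h1 0
  simp only [fun v => (hd v).deriv] at h3
  simp only [integral_const_mul, h3, mul_neg]

/-- Multiplication by a number of modulus one, as an isometry of the plane. -/
def rotationOfNorm (c : ℂ) (hc : ‖c‖ = 1) : ℂ ≃ₗᵢ[ℝ] ℂ :=
  rotation ⟨c, mem_sphere_zero_iff_norm.2 hc⟩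

theorem rotationOfNorm_apply (c : ℂ) (hc : ‖c‖ = 1) (x : ℂ) : rotationOfNorm c hc x = c * x := rfl

/-- The shear `(u, v) ↦ (u, v + γ(u))`. -/
def shearHomeomorph (γ : ℝ → ℝ) (hγ : Continuous γ) : ℝ × ℝ ≃ₜ ℝ × ℝ where
  toFun z := (z.1, z.2 + γ z.1)
  invFun z := (z.1, z.2 - γ z.1)
  left_inv z := by simp
  right_inv z := by simp
  continuous_toFun := by fun_prop
  continuous_invFun := by fun_prop


theorem measurePreserving_shearHomeomorph (γ : ℝ → ℝ) (hγ : Continuous γ) :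
    MeasurePreserving (shearHomeomorph γ hγ) volume volume := by
  refine (MeasurePreserving.id volume).skew_product (g := fun u v => v + γ u) ?_ ?_
  · exact (show Continuous fun z : ℝ × ℝ => z.2 + γ z.1 by fun_prop).measurable
  · exact ae_of_all _ fun u => (measurePreserving_add_right volume (γ u)).map_eq

/-- The linear part of a boundary chart: the inverse of the rotation `x ↦ c x`, written in real
coordinates. -/
def chartLinear (c : ℂ) (hc : ‖c‖ = 1) : (ℝ × ℝ) ≃L[ℝ] ℂ :=
  Complex.equivRealProdCLM.symm.trans (rotationOfNorm c hc).symm.toContinuousLinearEquiv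

theorem mul_chartLinear (c : ℂ) (hc : ‖c‖ = 1) (z : ℝ × ℝ) :
    c * chartLinear c hc z = ⟨z.1, z.2⟩ := by
  have h : rotationOfNorm c hc (chartLinear c hc z) = Complex.equivRealProdCLM.symm z :=
    (rotationOfNorm c hc).apply_symm_apply _
  rw [rotationOfNorm_apply] at h
  rw [h]; rfl

theorem measurePreserving_chartLinear (c : ℂ) (hc : ‖c‖ = 1) :
    MeasurePreserving (chartLinear c hc) volume volume :=
  (rotationOfNorm c hc).symm.measurePreserving.comp
    (Complex.volume_preserving_equiv_real_prod.symm Complex.measurableEquivRealProd)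

theorem exists_chartLinear_eq (c : ℂ) (hc : ‖c‖ = 1) (w : ℂ) :
    chartLinear c hc ((c * w).re, (c * w).im) = w := by
  have hc0 : c ≠ 0 := norm_ne_zero_iff.1 (by rw [hc]; exact one_ne_zero)
  exact mul_left_cancel₀ hc0 (mul_chartLinear c hc _)

namespace IsBdryChart

variable {D : Set ℂ} {p c : ℂ} {r : ℝ} {γ : ℝ → ℝ}

/-- The coordinates that straighten the boundary: the boundary becomes `v = 0`, the domain becomes
`v > 0`, and areas are preserved. -/
def straighten (h : IsBdryChart D p c r γ) : ℝ × ℝ ≃ₜ ℂ :=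
  (shearHomeomorph γ h.contDiff.continuous).trans (chartLinear c h.norm_eq_one).toHomeomorph

theorem mul_straighten (h : IsBdryChart D p c r γ) (z : ℝ × ℝ) :
    c * h.straighten z = ⟨z.1, z.2 + γ z.1⟩ := mul_chartLinear c h.norm_eq_one _

theorem measurePreserving_straighten (h : IsBdryChart D p c r γ) :
    MeasurePreserving h.straighten volume volume :=
  (measurePreserving_chartLinear c h.norm_eq_one).comp (measurePreserving_shearHomeomorph γ _)

theorem hasFDerivAt_straighten (h : IsBdryChart D p c r γ) (z : ℝ × ℝ) :
    HasFDerivAt h.straighten (((chartLinear c h.norm_eq_one) : (ℝ × ℝ) →L[ℝ] ℂ).comp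
      ((ContinuousLinearMap.fst ℝ ℝ ℝ).prod (ContinuousLinearMap.snd ℝ ℝ ℝ +
        deriv γ z.1 • ContinuousLinearMap.fst ℝ ℝ ℝ))) z := by
  have hd : HasDerivAt γ (deriv γ z.1) z.1 :=
    ((h.contDiff.differentiable (by norm_num)) _).hasDerivAt
  have h1 : HasFDerivAt (fun z : ℝ × ℝ => γ z.1)
      (deriv γ z.1 • ContinuousLinearMap.fst ℝ ℝ ℝ) z :=
    hd.comp_hasFDerivAt z hasFDerivAt_fst
  exact (chartLinear c h.norm_eq_one).hasFDerivAt.comp z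
    (hasFDerivAt_fst.prodMk (hasFDerivAt_snd.add h1))

theorem contDiff_straighten (h : IsBdryChart D p c r γ) : ContDiff ℝ 1 h.straighten := by
  have hγ : ContDiff ℝ 1 γ := h.contDiff.of_le one_le_two
  exact (chartLinear c h.norm_eq_one).contDiff.comp
    (contDiff_fst.prodMk (contDiff_snd.add (hγ.comp contDiff_fst)))

/-- The left-hand side of the divergence theorem in a chart: only the derivative transversal to the
boundary contributes. -/
theorem setIntegral_fderiv (h : IsBdryChart D p c r γ) {f : ℂ → ℝ} (hf : ContDiff ℝ 1 f)
    (hs : tsupport f ⊆ Metric.ball p r) (w : ℂ) :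
    ∫ x in D, fderiv ℝ f x w =
      ∫ t, ((c * w).re * deriv γ t - (c * w).im) * f (h.straighten (t, 0)) := by
  have hcs : HasCompactSupport f := Metric.isCompact_of_isClosed_isBounded (isClosed_tsupport f)
    (Metric.isBounded_ball.subset hs)
  set F : ℝ × ℝ → ℝ := f ∘ h.straighten with hFdef
  have hF : ContDiff ℝ 1 F := hf.comp h.contDiff_straighten
  have hFc : HasCompactSupport F := hcs.comp_homeomorph h.straighten
  have hγ : Continuous (deriv γ) := (h.contDiff.of_le one_le_two).continuous_deriv le_rfl
  have hD : ∫ x in D, fderiv ℝ f x w =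
      ∫ x in {x | γ (c * x).re < (c * x).im}, fderiv ℝ f x w := by
    have hsupp : ∀ x ∉ Metric.ball p r, fderiv ℝ f x w = 0 := fun x hx => by
      have : x ∉ tsupport (fderiv ℝ f) := fun hx' => hx (hs (tsupport_fderiv_subset ℝ hx'))
      rw [image_eq_zero_of_notMem_tsupport this]; rfl
    have hres : ∀ E : Set ℂ, ∫ x in E, fderiv ℝ f x w =
        ∫ x in E ∩ Metric.ball p r, fderiv ℝ f x w := fun E => by
      rw [← setIntegral_indicator Metric.isOpen_ball.measurableSet]
      congr 1
      ext x
      by_cases hx : x ∈ Metric.ball p r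
      · rw [Set.indicator_of_mem hx]
      · rw [Set.indicator_of_notMem hx, hsupp x hx]
    rw [hres, hres {x | _}]
    congr 2
    ext x
    simp only [Set.mem_inter_iff, Set.mem_ofPred_eq]
    exact and_congr_left fun hx => h.mem_iff x hx
  have hpre : h.straighten ⁻¹' {x | γ (c * x).re < (c * x).im} = Set.univ ×ˢ Set.Ioi 0 := by
    ext z
    rw [Set.mem_preimage, Set.mem_ofPred_eq, h.mul_straighten]
    simp
  -- decomposition of `w` along the coordinate directions of the straightened boundary
  have hfd : ∀ z, fderiv ℝ f (h.straighten z) w = (c * w).re * fderiv ℝ F z (1, 0) +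
      ((c * w).im - (c * w).re * deriv γ z.1) * fderiv ℝ F z (0, 1) := by
    intro z
    have hcomp := ((hf.differentiable one_ne_zero) (h.straighten z)).hasFDerivAt.comp z
      (h.hasFDerivAt_straighten z)
    rw [hcomp.fderiv, ← smul_eq_mul (c * w).re, ← smul_eq_mul (_ - _), ← map_smul, ← map_smul,
      ← map_add]
    conv_lhs => rw [← exists_chartLinear_eq c h.norm_eq_one w]
    simp only [ContinuousLinearMap.comp_apply]
    refine congrArg _ (congrArg (chartLinear c h.norm_eq_one) (Prod.ext ?_ ?_))
    · simp
    · simp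
      ring
  have hi : ∀ (e : ℝ × ℝ) {k : ℝ → ℝ}, Continuous k →
      IntegrableOn (fun z => k z.1 * fderiv ℝ F z e) (Set.univ ×ˢ Set.Ioi (0 : ℝ)) := by
    intro e k hk
    have hcont : Continuous fun z => fderiv ℝ F z e :=
      (hF.continuous_fderiv one_ne_zero).clm_apply continuous_const
    have hcs : HasCompactSupport fun z => fderiv ℝ F z e := hFc.fderiv_apply ℝ e
    exact (((hk.comp continuous_fst).mul hcont).integrable_of_hasCompactSupport
      hcs.mul_left).integrableOn
  have hk : Continuous fun t => (c * w).im - (c * w).re * deriv γ t := by fun_prop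
  rw [hD, ← h.measurePreserving_straighten.setIntegral_preimage_emb
    h.straighten.measurableEmbedding, hpre]
  simp only [hfd]
  rw [integral_add (hi (1, 0) continuous_const) (hi (0, 1) hk), integral_const_mul,
    integral_halfPlane_fderiv_fst hF hFc, integral_halfPlane_mul_fderiv_snd hF hFc hk, mul_zero,
    zero_add, ← integral_neg]
  refine integral_congr_ae (ae_of_all _ fun t => ?_)
  simp only [hFdef, Function.comp_apply]
  ring

/-- The right-hand side of the divergence theorem in a chart: the length element cancels the
denominator of the unit normal vector. -/
theorem integral_bdry (h : IsBdryChart D p c r γ) (hD : IsOpen D) {f : ℂ → ℝ}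
    (hs : tsupport f ⊆ Metric.ball p r) (w : ℂ) :
    ∫ x, f x * ⟪w, outerNormal D x⟫_ℝ ∂(bdryMeasure D) =
      ∫ t, ((c * w).re * deriv γ t - (c * w).im) * f (h.straighten (t, 0)) := by
  have hγ : ContDiff ℝ 1 γ := h.contDiff.of_le one_le_two
  set ρ := rotationOfNorm c h.norm_eq_one
  have hρ : MeasurePreserving ρ (μH[1]) (μH[1]) :=
    ρ.toIsometryEquiv.measurePreserving_hausdorffMeasure 1
  set g : ℂ → ℝ := fun y => f (ρ.symm y) * ⟪w, normal c γ y.re⟫_ℝ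
  have hleft : ∫ x, f x * ⟪w, outerNormal D x⟫_ℝ ∂(bdryMeasure D) =
      ∫ x in ρ ⁻¹' Set.range (graphMap γ), g (ρ x) ∂(μH[1] : Measure ℂ) := by
    rw [bdryMeasure, ← integral_indicator isClosed_frontier.measurableSet, ← integral_indicator
      (ρ.continuous.measurable (measurableEmbedding_graphMap hγ.continuous).measurableSet_range)]
    refine integral_congr_ae (ae_of_all _ fun x => ?_)
    by_cases hx : x ∈ Metric.ball p r
    · have hiff : x ∈ frontier D ↔ x ∈ ρ ⁻¹' Set.range (graphMap γ) := by
        rw [h.mem_frontier_iff hD hx]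
        constructor
        · intro h2; exact ⟨(c * x).re, Complex.ext rfl h2.symm⟩
        · rintro ⟨t, ht⟩
          have ht : graphMap γ t = c * x := ht
          rw [← ht]; rfl
      by_cases hxD : x ∈ frontier D
      · rw [Set.indicator_of_mem hxD, Set.indicator_of_mem (hiff.1 hxD),
          h.outerNormal_eq hD hx hxD]
        simp only [g, LinearIsometryEquiv.symm_apply_apply]
        rfl
      · rw [Set.indicator_of_notMem hxD, Set.indicator_of_notMem (hiff.not.1 hxD)]
    · have h0 : f x = 0 := image_eq_zero_of_notMem_tsupport fun hx' => hx (hs hx')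
      simp only [Set.indicator, g, LinearIsometryEquiv.symm_apply_apply, h0, zero_mul, ite_self]
  rw [hleft, hρ.setIntegral_preimage_emb ρ.toHomeomorph.measurableEmbedding g,
    setIntegral_range_graphMap hγ]
  refine integral_congr_ae (ae_of_all _ fun t => ?_)
  have hst : ρ.symm (graphMap γ t) = h.straighten (t, 0) := by
    rw [LinearIsometryEquiv.symm_apply_eq]
    change _ = c * _
    rw [h.mul_straighten, zero_add]; rfl
  simp only [g, hst]
  rw [inner_normal]
  have := (graphSpeed_pos γ t).ne'
  simp only [graphMap]
  field_simp

/-- The divergence theorem for functions supported in a boundary chart. -/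
theorem setIntegral_fderiv_eq_integral_bdry (h : IsBdryChart D p c r γ) (hD : IsOpen D)
    {f : ℂ → ℝ} (hf : ContDiff ℝ 1 f) (hs : tsupport f ⊆ Metric.ball p r) (w : ℂ) :
    ∫ x in D, fderiv ℝ f x w = ∫ x, f x * ⟪w, outerNormal D x⟫_ℝ ∂(bdryMeasure D) := by
  rw [h.setIntegral_fderiv hf hs, h.integral_bdry hD hs]

end IsBdryChart


/-- Every point of the closure has a chart: around an interior point the domain is, locally, the
region above a low horizontal line. -/
theorem IsBoundedC2Domain.exists_isBdryChart_of_mem_closure {D : Set ℂ} (hD : IsBoundedC2Domain D)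
    {p : ℂ} (hp : p ∈ closure D) : ∃ c r γ, IsBdryChart D p c r γ := by
  by_cases hpD : p ∈ D
  · obtain ⟨r, hr, hball⟩ := Metric.isOpen_iff.1 hD.isOpen p hpD
    refine ⟨1, r, fun _ => p.im - r, norm_one, hr, contDiff_const, fun x hx => ?_⟩
    refine iff_of_true (hball hx) ?_
    have h1 := (Complex.abs_im_le_norm (x - p)).trans_lt (mem_ball_iff_norm.1 hx)
    rw [Complex.sub_im] at h1
    rw [one_mul]
    linarith [(abs_lt.1 h1).1]
  · exact hD.exists_isBdryChart (by rw [hD.isOpen.frontier_eq]; exact ⟨hp, hpD⟩)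

open scoped Manifold ContDiff in
/-- The divergence theorem, for the vector field `f w` with a constant vector `w`. -/
theorem IsBoundedC2Domain.setIntegral_fderiv_eq_integral_bdry {D : Set ℂ}
    (hD : IsBoundedC2Domain D) {f : ℂ → ℝ} (hf : ContDiff ℝ 1 f) (w : ℂ) :
    ∫ x in D, fderiv ℝ f x w = ∫ x, f x * ⟪w, outerNormal D x⟫_ℝ ∂(bdryMeasure D) := by
  have := hD.isFiniteMeasure_bdryMeasure
  choose c r γ h using fun p (hp : p ∈ closure D) => hD.exists_isBdryChart_of_mem_closure hp
  have hcomp : IsCompact (closure D) := hD.isBounded.isCompact_closure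
  obtain ⟨t, ht⟩ := hcomp.elim_nhds_subcover' (fun p hp => Metric.ball p (r p hp))
    fun p hp => Metric.ball_mem_nhds p (h p hp).pos
  obtain ⟨ρ, hρ⟩ := SmoothPartitionOfUnity.exists_isSubordinate 𝓘(ℝ, ℂ) (s := closure D)
    isClosed_closure (fun i : t => Metric.ball i.1.1 (r i.1.1 i.1.2))
    (fun _ => Metric.isOpen_ball) (by
      intro x hx
      obtain ⟨i, hi, hxi⟩ := Set.mem_iUnion₂.1 (ht hx)
      exact Set.mem_iUnion.2 ⟨⟨i, hi⟩, hxi⟩)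
  have hρ1 : ∀ x ∈ closure D, ∑ i, ρ i x = 1 := fun x hx => by
    rw [← finsum_eq_sum_of_fintype]; exact ρ.sum_eq_one hx
  have hρd : ∀ i, ContDiff ℝ 1 (fun x => ρ i x * f x) := fun i =>
    ((ρ i).contMDiff.contDiff.of_le (by exact_mod_cast le_top)).mul hf
  have hρs : ∀ i : t, tsupport (fun x => ρ i x * f x) ⊆ Metric.ball i.1.1 (r i.1.1 i.1.2) :=
    fun i => (tsupport_mul_subset_left).trans (hρ i)
  have hρc : ∀ i : t, HasCompactSupport (fun x => ρ i x * f x) := fun i =>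
    Metric.isCompact_of_isClosed_isBounded (isClosed_tsupport _)
      (Metric.isBounded_ball.subset (hρs i))
  have hL : ∫ x in D, fderiv ℝ f x w =
      ∑ i, ∫ x in D, fderiv ℝ (fun x => ρ i x * f x) x w := by
    rw [← integral_finsetSum]
    · refine setIntegral_congr_fun hD.isOpen.measurableSet fun x hx => ?_
      have hev : f =ᶠ[𝓝 x] fun x => ∑ i, ρ i x * f x := by
        filter_upwards [hD.isOpen.mem_nhds hx] with y hy
        rw [← Finset.sum_mul, hρ1 y (subset_closure hy), one_mul]
      rw [hev.fderiv_eq, fderiv_fun_sum fun i _ => (hρd i).differentiable one_ne_zero x]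
      simp
    · intro i _
      exact ((((hρd i).continuous_fderiv one_ne_zero).clm_apply
        continuous_const).integrable_of_hasCompactSupport
          ((hρc i).fderiv_apply ℝ w)).integrableOn
  have hR : ∫ x, f x * ⟪w, outerNormal D x⟫_ℝ ∂(bdryMeasure D) =
      ∑ i, ∫ x, ρ i x * f x * ⟪w, outerNormal D x⟫_ℝ ∂(bdryMeasure D) := by
    rw [← integral_finsetSum]
    · refine integral_congr_ae ?_
      filter_upwards [ae_mem_frontier D] with x hx
      rw [← Finset.sum_mul, ← Finset.sum_mul, hρ1 x (frontier_subset_closure hx), one_mul]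
    · intro i _
      have hmeas : AEStronglyMeasurable (fun x => ⟪w, outerNormal D x⟫_ℝ) (bdryMeasure D) :=
        aestronglyMeasurable_const.inner hD.aestronglyMeasurable_outerNormal
      refine ((hρd i).continuous.integrable_of_hasCompactSupport (μ := bdryMeasure D)
        (hρc i)).mul_bdd (c := ‖w‖) hmeas ?_
      filter_upwards [ae_mem_frontier D] with x hx
      refine (abs_real_inner_le_norm _ _).trans ?_
      rw [hD.norm_outerNormal hx, mul_one]
  rw [hL, hR]
  exact Finset.sum_congr rfl fun i _ =>
    (h i.1.1 i.1.2).setIntegral_fderiv_eq_integral_bdry hD.isOpen (hρd i) (hρs i) w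

/-! ### The double layer potential of a constant -/

/-- The regularized squared distance `|x - y|² + ε²`. -/
def regDist (y : ℂ) (ε : ℝ) (x : ℂ) : ℝ := ‖x - y‖ ^ 2 + ε ^ 2

theorem regDist_pos (y : ℂ) {ε : ℝ} (hε : 0 < ε) (x : ℂ) : 0 < regDist y ε x := by
  unfold regDist; positivity

theorem hasFDerivAt_regDist (y : ℂ) (ε : ℝ) (x : ℂ) :
    HasFDerivAt (regDist y ε) (2 • innerSL ℝ (x - y)) x := by
  have h : HasFDerivAt (fun x : ℂ => x - y) (ContinuousLinearMap.id ℝ ℂ) x :=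
    (hasFDerivAt_id x).sub_const y
  exact h.norm_sq.add_const (ε ^ 2)

/-- The divergence of the field `(x - y) / (|x - y|² + ε²)` is `2 ε² / (|x - y|² + ε²)²`. -/
theorem IsBoundedC2Domain.integral_regularized_kernel {D : Set ℂ} (hD : IsBoundedC2Domain D)
    (y : ℂ) {ε : ℝ} (hε : 0 < ε) :
    ∫ x, ⟪x - y, outerNormal D x⟫_ℝ / regDist y ε x ∂(bdryMeasure D) =
      ∫ x in D, 2 * ε ^ 2 / regDist y ε x ^ 2 := by
  have := hD.isFiniteMeasure_bdryMeasure
  have hq : ContDiff ℝ 1 (regDist y ε) :=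
    ((contDiff_id.sub contDiff_const).norm_sq ℝ).add contDiff_const
  have hq0 : ∀ x, regDist y ε x ≠ 0 := fun x => (regDist_pos y hε x).ne'
  have key : ∀ (A : ℂ →L[ℝ] ℝ),
      ContDiff ℝ 1 (fun x => A (x - y) * (regDist y ε x)⁻¹) ∧
      ∀ x w, fderiv ℝ (fun x => A (x - y) * (regDist y ε x)⁻¹) x w =
        A w * (regDist y ε x)⁻¹ - A (x - y) * (2 * ⟪x - y, w⟫_ℝ) / regDist y ε x ^ 2 := by
    intro A
    refine ⟨(A.contDiff.comp (contDiff_id.sub contDiff_const)).mul (hq.inv hq0), fun x w => ?_⟩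
    have h1 : HasFDerivAt (fun x : ℂ => A (x - y)) A x := by
      exact A.hasFDerivAt.comp x ((hasFDerivAt_id x).sub_const y)
    have h2 := (hasDerivAt_inv (hq0 x)).comp_hasFDerivAt x (hasFDerivAt_regDist y ε x)
    have h3 := h1.mul h2
    have h4 := congrArg (fun L => L w) h3.fderiv
    refine h4.trans ?_
    simp
    field_simp
    ring
  obtain ⟨hre, hre'⟩ := key Complex.reCLM
  obtain ⟨him, him'⟩ := key Complex.imCLM
  have hi : ∀ {f : ℂ → ℝ} (w : ℂ), ContDiff ℝ 1 f →
      Integrable (fun x => f x * ⟪w, outerNormal D x⟫_ℝ) (bdryMeasure D) ∧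
      IntegrableOn (fun x => fderiv ℝ f x w) D := by
    intro f w hf
    constructor
    · obtain ⟨C, hC⟩ :=
        hD.isCompact_frontier.exists_bound_of_continuousOn hf.continuous.continuousOn
      refine Integrable.of_bound (hf.continuous.aestronglyMeasurable.mul
        (aestronglyMeasurable_const.inner hD.aestronglyMeasurable_outerNormal)) (C * ‖w‖) ?_
      filter_upwards [ae_mem_frontier D] with x hx
      rw [norm_mul]
      have h1 := norm_inner_le_norm (𝕜 := ℝ) w (outerNormal D x)
      rw [hD.norm_outerNormal hx, mul_one] at h1
      have := (norm_nonneg _).trans (hC x hx)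
      gcongr
      exact hC x hx
    · exact (((hf.continuous_fderiv one_ne_zero).clm_apply
        continuous_const).continuousOn.integrableOn_compact
          hD.isBounded.isCompact_closure).mono_set subset_closure
  have e1 := hD.setIntegral_fderiv_eq_integral_bdry hre 1
  have e2 := hD.setIntegral_fderiv_eq_integral_bdry him Complex.I
  calc ∫ x, ⟪x - y, outerNormal D x⟫_ℝ / regDist y ε x ∂(bdryMeasure D)
      = ∫ x, (Complex.reCLM (x - y) * (regDist y ε x)⁻¹ * ⟪1, outerNormal D x⟫_ℝ +
          Complex.imCLM (x - y) * (regDist y ε x)⁻¹ * ⟪Complex.I, outerNormal D x⟫_ℝ)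
            ∂(bdryMeasure D) := by
        refine integral_congr_ae (ae_of_all _ fun x => ?_)
        simp only [Complex.inner, Complex.mul_re, Complex.conj_re, Complex.conj_im,
          Complex.reCLM_apply, Complex.imCLM_apply, Complex.one_re, Complex.one_im, Complex.I_re,
          Complex.I_im]
        ring
    _ = ∫ x in D, (fderiv ℝ (fun x => Complex.reCLM (x - y) * (regDist y ε x)⁻¹) x 1 +
          fderiv ℝ (fun x => Complex.imCLM (x - y) * (regDist y ε x)⁻¹) x Complex.I) := by
        rw [integral_add (hi 1 hre).1 (hi Complex.I him).1,
          integral_add (hi 1 hre).2 (hi Complex.I him).2, e1, e2]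
    _ = _ := by
        refine integral_congr_ae (ae_of_all _ fun x => ?_)
        have hx := hq0 x
        have hn : regDist y ε x = (x - y).re ^ 2 + (x - y).im ^ 2 + ε ^ 2 := by
          rw [regDist, ← Complex.normSq_eq_norm_sq, Complex.normSq_apply]; ring
        simp only [hre', him']
        simp only [Complex.inner, Complex.mul_re, Complex.conj_re, Complex.conj_im,
          Complex.reCLM_apply, Complex.imCLM_apply, Complex.one_re, Complex.one_im, Complex.I_re,
          Complex.I_im]
        field_simp
        rw [hn]
        ring

theorem integral_Ioi_two_mul_div_sq : ∫ r in Set.Ioi (0 : ℝ), r * (2 / (r ^ 2 + 1) ^ 2) = 1 := by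
  have hd : ∀ r ∈ Set.Ici (0 : ℝ), HasDerivAt (fun r : ℝ => -(r ^ 2 + 1)⁻¹)
      (r * (2 / (r ^ 2 + 1) ^ 2)) r := fun r _ => by
    have h1 : HasDerivAt (fun r : ℝ => r ^ 2 + 1) (2 * r) r := by
      simpa using (hasDerivAt_pow 2 r).add_const 1
    have h2 := (h1.inv (by positivity)).neg
    convert! h2 using 1
    ring
  have hlim : Tendsto (fun r : ℝ => -(r ^ 2 + 1)⁻¹) atTop (𝓝 0) := by
    have : Tendsto (fun r : ℝ => r ^ 2 + 1) atTop atTop :=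
      tendsto_atTop_add_const_right _ _ (tendsto_pow_atTop two_ne_zero)
    simpa using this.inv_tendsto_atTop.neg
  have := integral_Ioi_of_hasDerivAt_of_nonneg' hd
    (fun r hr => mul_nonneg (le_of_lt hr) (by positivity)) hlim
  rw [this]; norm_num

theorem integral_two_div_sq : ∫ u : ℂ, 2 / (‖u‖ ^ 2 + 1) ^ 2 = 2 * Real.pi := by
  have h := integral_fun_norm_addHaar (volume : Measure ℂ) (fun r : ℝ => 2 / (r ^ 2 + 1) ^ 2)
  rw [h, Complex.finrank_real_complex, Measure.real, Complex.volume_ball]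
  simp [integral_Ioi_two_mul_div_sq]

theorem integrable_two_div_sq : Integrable fun u : ℂ => 2 / (‖u‖ ^ 2 + 1) ^ 2 :=
  Integrable.of_integral_ne_zero (by rw [integral_two_div_sq]; positivity)

theorem volume_inner_eq_zero {ν : ℂ} (hν : ν ≠ 0) : volume {u : ℂ | ⟪u, ν⟫_ℝ = 0} = 0 := by
  have h := Measure.addHaar_submodule (volume : Measure ℂ) (LinearMap.ker (innerSL ℝ ν).toLinearMap)
    (fun htop => hν (by
      have h1 : ν ∈ LinearMap.ker (innerSL ℝ ν).toLinearMap := htop ▸ Submodule.mem_top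
      simpa using! h1))
  convert! h using 2
  ext u
  rw [Set.mem_ofPred_eq, real_inner_comm]
  rfl

/-- The kernel `2 / (|u|² + 1)²` has half of its mass on a half-plane. -/
theorem setIntegral_halfPlane_two_div_sq {ν : ℂ} (hν : ν ≠ 0) :
    ∫ u in {u : ℂ | ⟪u, ν⟫_ℝ < 0}, 2 / (‖u‖ ^ 2 + 1) ^ 2 = Real.pi := by
  set g : ℂ → ℝ := fun u => 2 / (‖u‖ ^ 2 + 1) ^ 2
  have hopen : IsOpen {u : ℂ | ⟪u, ν⟫_ℝ < 0} := isOpen_lt (by fun_prop) (by fun_prop)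
  have hsymm : ∫ u in {u : ℂ | ⟪u, ν⟫_ℝ < 0}ᶜ, g u = ∫ u in {u : ℂ | ⟪u, ν⟫_ℝ < 0}, g u := by
    have h1 := (Measure.measurePreserving_neg (volume : Measure ℂ)).setIntegral_preimage_emb
      (Homeomorph.neg ℂ).measurableEmbedding g {u : ℂ | ⟪u, ν⟫_ℝ < 0}
    rw [← h1]
    simp only [g, norm_neg]
    refine setIntegral_congr_set ?_
    have h0 : ∀ᵐ u : ℂ, ⟪u, ν⟫_ℝ ≠ 0 := by
      rw [ae_iff]; simpa using volume_inner_eq_zero hν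
    filter_upwards [h0] with u hu
    refine propext ?_
    change ¬ (⟪u, ν⟫_ℝ < 0) ↔ ⟪-u, ν⟫_ℝ < 0
    rw [inner_neg_left, neg_lt_zero, not_lt]
    exact ⟨fun h => lt_of_le_of_ne h hu.symm, le_of_lt⟩
  have hsum := integral_add_compl hopen.measurableSet integrable_two_div_sq
  rw [hsymm, integral_two_div_sq] at hsum
  linarith

/-- Blowing up at a boundary point turns the domain into a half-plane. -/
theorem IsBoundedC2Domain.tendsto_setIntegral_regDist {D : Set ℂ} (hD : IsBoundedC2Domain D)
    {y : ℂ} (hy : y ∈ frontier D) :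
    Tendsto (fun ε : ℝ => ∫ x in D, 2 * ε ^ 2 / regDist y ε x ^ 2) (𝓝[>] 0) (𝓝 Real.pi) := by
  obtain ⟨ν, hν⟩ := hD.exists_isOuterUnitNormal hy
  have hν0 : ν ≠ 0 := norm_ne_zero_iff.1 (by rw [hν.1]; exact one_ne_zero)
  set g : ℂ → ℝ := fun u => 2 / (‖u‖ ^ 2 + 1) ^ 2 with hg
  have hH : IsOpen {u : ℂ | ⟪u, ν⟫_ℝ < 0} := isOpen_lt (by fun_prop) (by fun_prop)
  -- the substitution `x = y + ε u`
  have hresc : ∀ ε : ℝ, 0 < ε → ∫ x in D, 2 * ε ^ 2 / regDist y ε x ^ 2 =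
      ∫ u : ℂ, D.indicator (fun _ => (1 : ℝ)) (y + ε • u) * g u := by
    intro ε hε
    have h1 := Measure.integral_comp_smul (volume : Measure ℂ)
      (fun v => D.indicator (fun x => 2 * ε ^ 2 / regDist y ε x ^ 2) (y + v)) ε
    rw [integral_add_left_eq_self (fun x => D.indicator
      (fun x => 2 * ε ^ 2 / regDist y ε x ^ 2) x) y, integral_indicator hD.isOpen.measurableSet,
      Complex.finrank_real_complex, abs_of_pos (by positivity), smul_eq_mul] at h1
    rw [inv_mul_eq_div, eq_div_iff (by positivity), ← integral_mul_const] at h1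
    rw [← h1]
    refine integral_congr_ae (ae_of_all _ fun u => ?_)
    simp only [Set.indicator, hg]
    split_ifs
    · have : regDist y ε (y + ε • u) = ε ^ 2 * (‖u‖ ^ 2 + 1) := by
        rw [regDist, add_sub_cancel_left, norm_smul, Real.norm_of_nonneg hε.le]; ring
      rw [this]
      have : (‖u‖ ^ 2 + 1) ≠ 0 := by positivity
      field_simp
    · simp
  have hlim : Tendsto (fun ε : ℝ => ∫ u : ℂ, D.indicator (fun _ => (1 : ℝ)) (y + ε • u) * g u)
      (𝓝[>] 0) (𝓝 (∫ u, {u : ℂ | ⟪u, ν⟫_ℝ < 0}.indicator (fun _ => (1 : ℝ)) u * g u)) := by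
    refine tendsto_integral_filter_of_dominated_convergence g ?_ ?_ integrable_two_div_sq ?_
    · refine Eventually.of_forall fun ε => ?_
      have hm : Measurable fun u : ℂ => D.indicator (fun _ => (1 : ℝ)) (y + ε • u) :=
        (measurable_const.indicator hD.isOpen.measurableSet).comp (by fun_prop)
      exact hm.aestronglyMeasurable.mul integrable_two_div_sq.aestronglyMeasurable
    · refine Eventually.of_forall fun ε => ae_of_all _ fun u => ?_
      have hg0 : 0 ≤ g u := by positivity
      rw [norm_mul, Real.norm_of_nonneg hg0]
      refine mul_le_of_le_one_left hg0 ?_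
      simp only [Set.indicator]
      split_ifs <;> simp
    · have h0 : ∀ᵐ u : ℂ, ⟪u, ν⟫_ℝ ≠ 0 := by
        rw [ae_iff]; simpa using volume_inner_eq_zero hν0
      filter_upwards [h0] with u hu
      refine Tendsto.mul_const _ (tendsto_const_nhds.congr' ?_)
      have hu0 : 0 < ‖u‖ := norm_pos_iff.2 (by rintro rfl; simp at hu)
      have hcont : Tendsto (fun ε : ℝ => y + ε • u) (𝓝[>] 0) (𝓝 y) := by
        have : Tendsto (fun ε : ℝ => y + ε • u) (𝓝 0) (𝓝 (y + (0 : ℝ) • u)) :=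
          Continuous.tendsto (by fun_prop) 0
        simp only [zero_smul, add_zero] at this
        exact this.mono_left nhdsWithin_le_nhds
      -- the cone of opening `|⟨u, ν⟩| / (2 |u|)` contains the ray through `u`
      have hδ : 0 < |⟪u, ν⟫_ℝ| / (2 * ‖u‖) := by positivity
      filter_upwards [hcont.eventually (hν.2 _ hδ), self_mem_nhdsWithin] with ε hcone hε
      have hε : 0 < ε := hε
      have e : |⟪u, ν⟫_ℝ| / (2 * ‖u‖) * ‖ε • u‖ = ε * (|⟪u, ν⟫_ℝ| / 2) := by
        rw [norm_smul, Real.norm_of_nonneg hε.le]; field_simp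
      rw [add_sub_cancel_left, e, real_inner_smul_left, ← mul_neg, mul_lt_mul_iff_right₀ hε,
        mul_lt_mul_iff_right₀ hε] at hcone
      rcases lt_or_gt_of_ne hu with hneg | hpos
      · have hmem := hcone.1 (by rw [abs_of_neg hneg]; linarith)
        rw [Set.indicator_of_mem hmem, Set.indicator_of_mem (by exact hneg)]
      · have hmem := hcone.2 (by rw [abs_of_pos hpos]; linarith)
        rw [Set.indicator_of_notMem hmem, Set.indicator_of_notMem (by exact hpos.le.not_gt)]
  have hval : ∫ u, {u : ℂ | ⟪u, ν⟫_ℝ < 0}.indicator (fun _ => (1 : ℝ)) u * g u = Real.pi := by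
    rw [← setIntegral_halfPlane_two_div_sq hν0, ← integral_indicator hH.measurableSet]
    refine integral_congr_ae (ae_of_all _ fun u => ?_)
    simp only [Set.indicator]
    split_ifs <;> simp [hg]
  rw [hval] at hlim
  refine hlim.congr' ?_
  filter_upwards [self_mem_nhdsWithin] with ε hε using (hresc ε hε).symm

/-- The kernel of `𝒦_D^*`, without the factor `1 / (2π)`. -/
def npKernel (D : Set ℂ) (x y : ℂ) : ℝ := ⟪x - y, outerNormal D x⟫_ℝ / ‖x - y‖ ^ 2

namespace IsBoundedC2Domain

variable {D : Set ℂ}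

theorem exists_abs_npKernel_le (hD : IsBoundedC2Domain D) :
    ∃ C : ℝ, 0 ≤ C ∧ ∀ x ∈ frontier D, ∀ y ∈ frontier D, |npKernel D x y| ≤ C := by
  obtain ⟨C, hC⟩ := hD.exists_abs_inner_le
  refine ⟨max C 0, le_max_right _ _, fun x hx y hy => ?_⟩
  rcases eq_or_ne x y with rfl | hxy
  · simp [npKernel]
  · have hpos : 0 < ‖x - y‖ := norm_pos_iff.2 (sub_ne_zero.2 hxy)
    rw [npKernel, abs_div, abs_of_pos (by positivity : 0 < ‖x - y‖ ^ 2),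
      div_le_iff₀ (by positivity)]
    exact (hC x hx y hy).trans (by gcongr; exact le_max_left _ _)

/-- Gauss's formula: on the boundary, the double layer potential of the constant `1` is half its
value inside, that is `𝒦_D[1] = 1 / 2`. The factor `1 / (2π)` of the kernel is left out here. -/
theorem integral_npKernel (hD : IsBoundedC2Domain D) {y : ℂ} (hy : y ∈ frontier D) :
    ∫ x, npKernel D x y ∂(bdryMeasure D) = Real.pi := by
  have := hD.isFiniteMeasure_bdryMeasure
  obtain ⟨C, hC0, hC⟩ := hD.exists_abs_npKernel_le
  have hmeas : AEStronglyMeasurable (fun x => ⟪x - y, outerNormal D x⟫_ℝ) (bdryMeasure D) :=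
    (by fun_prop : Continuous fun x : ℂ => x - y).aestronglyMeasurable.inner
      hD.aestronglyMeasurable_outerNormal
  have hlim : Tendsto (fun ε : ℝ => ∫ x, ⟪x - y, outerNormal D x⟫_ℝ / regDist y ε x
      ∂(bdryMeasure D)) (𝓝[>] 0) (𝓝 (∫ x, npKernel D x y ∂(bdryMeasure D))) := by
    refine tendsto_integral_filter_of_dominated_convergence (fun _ => C) ?_ ?_
      (integrable_const C) ?_
    · refine Eventually.of_forall fun ε => ?_
      have hq : Measurable (regDist y ε) := by unfold regDist; fun_prop
      exact (hmeas.aemeasurable.div hq.aemeasurable).aestronglyMeasurable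
    · -- the regularization only increases the denominator, so the bound of the kernel applies
      filter_upwards [self_mem_nhdsWithin] with ε hε
      filter_upwards [ae_mem_frontier D] with x hx
      have hpos := regDist_pos y hε x
      rcases eq_or_ne x y with rfl | hxy
      · simpa using hC0
      · have hxy' : 0 < ‖x - y‖ := norm_pos_iff.2 (sub_ne_zero.2 hxy)
        refine le_trans ?_ (hC x hx y hy)
        rw [npKernel, Real.norm_eq_abs, abs_div, abs_div, abs_of_pos hpos,
          abs_of_pos (by positivity : 0 < ‖x - y‖ ^ 2)]
        gcongr
        rw [regDist]
        linarith [sq_nonneg ε]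
    · refine ae_of_all _ fun x => ?_
      rcases eq_or_ne x y with rfl | hxy
      · simp [npKernel]
      · have hxy' : 0 < ‖x - y‖ := norm_pos_iff.2 (sub_ne_zero.2 hxy)
        have hc : ContinuousAt (fun ε : ℝ => ⟪x - y, outerNormal D x⟫_ℝ / regDist y ε x) 0 := by
          unfold regDist
          refine ContinuousAt.div (by fun_prop) (by fun_prop) (by positivity)
        have h2 := hc.tendsto
        rw [regDist, zero_pow two_ne_zero, add_zero] at h2
        exact h2.mono_left nhdsWithin_le_nhds
  refine tendsto_nhds_unique hlim ((hD.tendsto_setIntegral_regDist hy).congr' ?_)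
  filter_upwards [self_mem_nhdsWithin] with ε hε using (hD.integral_regularized_kernel y hε).symm

end IsBoundedC2Domain

/-! ### Vanishing of the mean of `(lam I - 𝒦_D^*)⁻¹[∂f/∂ν]` -/

theorem npAdjoint_eq (D : Set ℂ) (φ : ℂ → ℂ) (x : ℂ) :
    npAdjoint D φ x = ((1 / (2 * Real.pi) : ℝ) : ℂ) *
      ∫ y, (npKernel D x y : ℂ) * φ y ∂(bdryMeasure D) := rfl

namespace IsBoundedC2Domain

variable {D : Set ℂ}

theorem aestronglyMeasurable_npKernel (hD : IsBoundedC2Domain D) :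
    AEStronglyMeasurable (fun q : ℂ × ℂ => (npKernel D q.1 q.2 : ℂ))
      ((bdryMeasure D).prod (bdryMeasure D)) := by
  have := hD.isFiniteMeasure_bdryMeasure
  have h1 : AEStronglyMeasurable (fun q : ℂ × ℂ => ⟪q.1 - q.2, outerNormal D q.1⟫_ℝ)
      ((bdryMeasure D).prod (bdryMeasure D)) :=
    (by fun_prop : Continuous fun q : ℂ × ℂ => q.1 - q.2).aestronglyMeasurable.inner
      hD.aestronglyMeasurable_outerNormal.comp_fst
  have h2 : Measurable fun q : ℂ × ℂ => ‖q.1 - q.2‖ ^ 2 := by fun_prop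
  exact Complex.continuous_ofReal.comp_aestronglyMeasurable
    (h1.aemeasurable.div h2.aemeasurable).aestronglyMeasurable

theorem integrable_npKernel_mul (hD : IsBoundedC2Domain D) {φ : ℂ → ℂ}
    (hφ : Integrable φ (bdryMeasure D)) {x : ℂ} (hx : x ∈ frontier D) :
    Integrable (fun y => (npKernel D x y : ℂ) * φ y) (bdryMeasure D) := by
  obtain ⟨C, -, hC⟩ := hD.exists_abs_npKernel_le
  refine hφ.bdd_mul (c := C) ?_ ?_
  · have h1 : Measurable fun y => npKernel D x y := by unfold npKernel; fun_prop
    exact (Complex.measurable_ofReal.comp h1).aestronglyMeasurable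
  · filter_upwards [ae_mem_frontier D] with y hy
    rw [Complex.norm_real]
    exact hC x hx y hy

theorem integrable_npKernel_mul_prod (hD : IsBoundedC2Domain D) {φ : ℂ → ℂ}
    (hφ : Integrable φ (bdryMeasure D)) :
    Integrable (fun q : ℂ × ℂ => (npKernel D q.1 q.2 : ℂ) * φ q.2)
      ((bdryMeasure D).prod (bdryMeasure D)) := by
  have := hD.isFiniteMeasure_bdryMeasure
  obtain ⟨C, -, hC⟩ := hD.exists_abs_npKernel_le
  refine (hφ.comp_snd (bdryMeasure D)).bdd_mul (c := C) hD.aestronglyMeasurable_npKernel ?_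
  have h1 := Measure.quasiMeasurePreserving_fst (μ := bdryMeasure D) (ν := bdryMeasure D)
    |>.ae (ae_mem_frontier D)
  have h2 := Measure.quasiMeasurePreserving_snd (μ := bdryMeasure D) (ν := bdryMeasure D)
    |>.ae (ae_mem_frontier D)
  filter_upwards [h1, h2] with q hq1 hq2
  rw [Complex.norm_real]
  exact hC _ hq1 _ hq2

theorem integrable_npAdjoint (hD : IsBoundedC2Domain D) {φ : ℂ → ℂ}
    (hφ : Integrable φ (bdryMeasure D)) : Integrable (npAdjoint D φ) (bdryMeasure D) := by
  have := hD.isFiniteMeasure_bdryMeasure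
  exact (hD.integrable_npKernel_mul_prod hφ).integral_prod_left.const_mul _

/-- The dual form of `𝒦_D[1] = 1 / 2`. -/
theorem integral_npAdjoint (hD : IsBoundedC2Domain D) {φ : ℂ → ℂ}
    (hφ : Integrable φ (bdryMeasure D)) :
    ∫ x, npAdjoint D φ x ∂(bdryMeasure D) = 1 / 2 * ∫ x, φ x ∂(bdryMeasure D) := by
  have := hD.isFiniteMeasure_bdryMeasure
  simp only [npAdjoint_eq]
  rw [integral_const_mul, integral_integral_swap (hD.integrable_npKernel_mul_prod hφ)]
  have h : ∫ y, ∫ x, (npKernel D x y : ℂ) * φ y ∂(bdryMeasure D) ∂(bdryMeasure D) =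
      Real.pi * ∫ x, φ x ∂(bdryMeasure D) := by
    rw [← integral_const_mul]
    refine integral_congr_ae ?_
    filter_upwards [ae_mem_frontier D] with y hy
    rw [integral_mul_const, integral_complex_ofReal, hD.integral_npKernel hy]
  rw [h]
  have hpi : (Real.pi : ℂ) ≠ 0 := Complex.ofReal_ne_zero.2 Real.pi_ne_zero
  push_cast
  field_simp

theorem memLp_of_continuousOn (hD : IsBoundedC2Domain D) {g : ℂ → ℂ}
    (hg : ContinuousOn g (frontier D)) : MemLp g 2 (bdryMeasure D) := by
  have := hD.isFiniteMeasure_bdryMeasure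
  obtain ⟨C, hC⟩ := hD.isCompact_frontier.exists_bound_of_continuousOn hg
  refine MemLp.of_bound (hg.aestronglyMeasurable isClosed_frontier.measurableSet) C ?_
  filter_upwards [ae_mem_frontier D] with x hx using hC x hx

theorem memLp_normalDeriv (hD : IsBoundedC2Domain D) {f : ℂ → ℂ} (hf : ContDiff ℝ 1 f) :
    MemLp (normalDeriv D f) 2 (bdryMeasure D) :=
  hD.memLp_of_continuousOn
    ((hf.continuous_fderiv one_ne_zero).continuousOn.clm_apply hD.continuousOn_outerNormal)

/-- Cauchy's theorem: the integral of `f ν` over the boundary vanishes for holomorphic `f`. -/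
theorem integral_mul_outerNormal_eq_zero (hD : IsBoundedC2Domain D) {f : ℂ → ℂ}
    (hf : ContDiff ℂ 1 f) : ∫ x, f x * outerNormal D x ∂(bdryMeasure D) = 0 := by
  have := hD.isFiniteMeasure_bdryMeasure
  have hfR : ContDiff ℝ 1 f := hf.restrict_scalars ℝ
  have hint : Integrable (fun x => f x * outerNormal D x) (bdryMeasure D) :=
    (hD.memLp_of_continuousOn (hf.continuous.continuousOn.mul
      hD.continuousOn_outerNormal)).integrable one_le_two
  have hre : ContDiff ℝ 1 fun x => (f x).re := Complex.reCLM.contDiff.comp hfR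
  have him : ContDiff ℝ 1 fun x => (f x).im := Complex.imCLM.contDiff.comp hfR
  have hfd : ∀ x w, fderiv ℝ f x w = deriv f x * w := fun x w => by
    rw [((hf.differentiable one_ne_zero x).hasDerivAt.hasFDerivAt.restrictScalars ℝ).fderiv]
    simp [mul_comm]
  have hfre : ∀ x w, fderiv ℝ (fun x => (f x).re) x w = (deriv f x * w).re := fun x w => by
    have h : HasFDerivAt (fun x => (f x).re) (Complex.reCLM.comp (fderiv ℝ f x)) x :=
      Complex.reCLM.hasFDerivAt.comp x (hfR.differentiable one_ne_zero x).hasFDerivAt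
    rw [← hfd, h.fderiv]
    rfl
  have hfim : ∀ x w, fderiv ℝ (fun x => (f x).im) x w = (deriv f x * w).im := fun x w => by
    have h : HasFDerivAt (fun x => (f x).im) (Complex.imCLM.comp (fderiv ℝ f x)) x :=
      Complex.imCLM.hasFDerivAt.comp x (hfR.differentiable one_ne_zero x).hasFDerivAt
    rw [← hfd, h.fderiv]
    rfl
  have hi : ∀ {u : ℂ → ℝ} (w : ℂ), ContDiff ℝ 1 u →
      Integrable (fun x => u x * ⟪w, outerNormal D x⟫_ℝ) (bdryMeasure D) := by
    intro u w hu
    have h := (hD.memLp_of_continuousOn (g := fun x => ((u x * ⟪w, outerNormal D x⟫_ℝ : ℝ) : ℂ))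
      (Complex.continuous_ofReal.comp_continuousOn (hu.continuous.continuousOn.mul
        (continuousOn_const.inner hD.continuousOn_outerNormal)))).integrable one_le_two
    simpa using! h.re
  have e1 := hD.setIntegral_fderiv_eq_integral_bdry hre 1
  have e2 := hD.setIntegral_fderiv_eq_integral_bdry him Complex.I
  have e3 := hD.setIntegral_fderiv_eq_integral_bdry hre Complex.I
  have e4 := hD.setIntegral_fderiv_eq_integral_bdry him 1
  simp only [hfre, hfim, mul_one, Complex.mul_I_re, Complex.mul_I_im] at e1 e2 e3 e4
  have hre0 : ∫ x, (f x * outerNormal D x).re ∂(bdryMeasure D) = 0 := by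
    calc _ = ∫ x, ((f x).re * ⟪1, outerNormal D x⟫_ℝ - (f x).im * ⟪Complex.I, outerNormal D x⟫_ℝ)
          ∂(bdryMeasure D) := by
          refine integral_congr_ae (ae_of_all _ fun x => ?_)
          simp [Complex.inner]
      _ = 0 := by rw [integral_sub (hi 1 hre) (hi Complex.I him), ← e1, ← e2, sub_self]
  have him0 : ∫ x, (f x * outerNormal D x).im ∂(bdryMeasure D) = 0 := by
    calc _ = ∫ x, ((f x).re * ⟪Complex.I, outerNormal D x⟫_ℝ + (f x).im * ⟪1, outerNormal D x⟫_ℝ)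
          ∂(bdryMeasure D) := by
          refine integral_congr_ae (ae_of_all _ fun x => ?_)
          simp [Complex.inner]
      _ = 0 := by
          rw [integral_add (hi Complex.I hre) (hi 1 him), ← e3, ← e4, integral_neg, neg_add_cancel]
  have h1 := integral_re_add_im hint
  simp only [RCLike.re_to_complex, RCLike.im_to_complex] at h1
  rw [← h1, hre0, him0]
  simp

theorem integral_normalDeriv_pow (hD : IsBoundedC2Domain D) (l : ℕ) :
    ∫ x, normalDeriv D (fun y => y ^ l) x ∂(bdryMeasure D) = 0 := by
  rw [← hD.integral_mul_outerNormal_eq_zero (f := fun x => (l : ℂ) * x ^ (l - 1)) (by fun_prop)]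
  refine integral_congr_ae (ae_of_all _ fun x => ?_)
  simp only [normalDeriv]
  rw [((hasDerivAt_pow l x).hasFDerivAt.restrictScalars ℝ).fderiv]
  simp [mul_comm]

theorem normalDeriv_conj {f : ℂ → ℂ} (hf : Differentiable ℝ f) (x : ℂ) :
    normalDeriv D (fun y => (starRingEnd ℂ) (f y)) x = (starRingEnd ℂ) (normalDeriv D f x) := by
  have h : HasFDerivAt (fun y => (starRingEnd ℂ) (f y))
      ((Complex.conjCLE : ℂ →L[ℝ] ℂ).comp (fderiv ℝ f x)) x :=
    Complex.conjCLE.hasFDerivAt.comp x (hf x).hasFDerivAt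
  rw [normalDeriv, h.fderiv]
  rfl

theorem integral_normalDeriv_conj_pow (hD : IsBoundedC2Domain D) (l : ℕ) :
    ∫ x, normalDeriv D (fun y => (starRingEnd ℂ) (y ^ l)) x ∂(bdryMeasure D) = 0 := by
  have hd : Differentiable ℝ fun y : ℂ => y ^ l := by fun_prop
  simp only [normalDeriv_conj hd]
  rw [integral_conj, hD.integral_normalDeriv_pow, map_zero]

variable {lam : ℝ}

theorem integrable_coeFn (hD : IsBoundedC2Domain D) (φ : BdryL2 D) :
    Integrable φ (bdryMeasure D) :=
  have := hD.isFiniteMeasure_bdryMeasure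
  (Lp.memLp φ).integrable one_le_two

/-- The solution `φ` of `(lam I - 𝒦_D^*) φ = g` has mean zero as soon as `g` has: integrating the
equation gives `(lam - 1 / 2) ∫ φ = ∫ g`. -/
theorem integral_inverseNP_eq_zero (hD : IsBoundedC2Domain D) (hlam : lam ≠ 1 / 2) {g : BdryL2 D}
    (hg : ∫ x, g x ∂(bdryMeasure D) = 0) :
    ∫ x, inverseNP lam D g x ∂(bdryMeasure D) = 0 := by
  by_cases h : ∃ R, IsInverseNP lam D R
  · obtain ⟨R, hR⟩ := h
    rw [hR.inverseNP_eq]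
    have hφ := hD.integrable_coeFn (R g)
    have h1 := integral_congr_ae ((hR (R g) g).1 rfl)
    rw [integral_sub (hφ.const_mul _) (hD.integrable_npAdjoint hφ), integral_const_mul,
      hD.integral_npAdjoint hφ, hg, ← sub_mul] at h1
    refine (mul_eq_zero.1 h1).resolve_left fun h2 => hlam ?_
    have h3 : ((lam - 1 / 2 : ℝ) : ℂ) = 0 := by push_cast; exact h2
    linarith [Complex.ofReal_eq_zero.1 h3]
  · rw [inverseNP, dif_neg h, Pi.zero_apply, integral_congr_ae (Lp.coeFn_zero ℂ 2 _)]
    simp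

/-! ### Bilinearity of the polarization form -/

theorem npAdjoint_add (hD : IsBoundedC2Domain D) {φ ψ : ℂ → ℂ}
    (hφ : Integrable φ (bdryMeasure D)) (hψ : Integrable ψ (bdryMeasure D)) {x : ℂ}
    (hx : x ∈ frontier D) : npAdjoint D (φ + ψ) x = npAdjoint D φ x + npAdjoint D ψ x := by
  simp only [npAdjoint_eq, Pi.add_apply, mul_add]
  rw [integral_add (hD.integrable_npKernel_mul hφ hx) (hD.integrable_npKernel_mul hψ hx), mul_add]

/-- The two cases are the existence of the inverse operator and its convention `0` otherwise. -/
theorem inverseNP_add (hD : IsBoundedC2Domain D) (g₁ g₂ : BdryL2 D) :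
    inverseNP lam D (g₁ + g₂) = inverseNP lam D g₁ + inverseNP lam D g₂ := by
  by_cases h : ∃ R, IsInverseNP lam D R
  · obtain ⟨R, hR⟩ := h
    rw [hR.inverseNP_eq, hR]
    filter_upwards [(hR _ g₁).1 rfl, (hR _ g₂).1 rfl, Lp.coeFn_add g₁ g₂,
      Lp.coeFn_add (R g₁) (R g₂), ae_mem_frontier D] with x h1 h2 h3 h4 hx
    rw [npAdjoint_congr_ae (Lp.coeFn_add (R g₁) (R g₂)), hD.npAdjoint_add (hD.integrable_coeFn _)
      (hD.integrable_coeFn _) hx, h3, h4, Pi.add_apply, Pi.add_apply, ← h1, ← h2]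
    ring
  · rw [inverseNP, dif_neg h, Pi.zero_apply, Pi.zero_apply, Pi.zero_apply, add_zero]

theorem toBdryL2_eq (hD : IsBoundedC2Domain D) {f : ℂ → ℂ} (hf : ContDiff ℝ 1 f) :
    toBdryL2 D (normalDeriv D f) = (hD.memLp_normalDeriv hf).toLp := by
  rw [toBdryL2, dif_pos]

/-- The polarization form does not see constants in its second argument if the normal derivative of
the first one has mean zero. -/
theorem polarForm_one_right (hD : IsBoundedC2Domain D) (hlam : lam ≠ 1 / 2)
    {f : ℂ → ℂ} (hf : ContDiff ℝ 1 f) (h0 : ∫ x, normalDeriv D f x ∂(bdryMeasure D) = 0) :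
    polarForm lam D f (fun _ => 1) = 0 := by
  simp only [polarForm, one_mul]
  refine hD.integral_inverseNP_eq_zero hlam ?_
  rw [hD.toBdryL2_eq hf, integral_congr_ae (MemLp.coeFn_toLp _), h0]

theorem toBdryL2_normalDeriv_sum (hD : IsBoundedC2Domain D) {ι : Type*} (s : Finset ι) (c : ι → ℂ)
    {f : ι → ℂ → ℂ} (hf : ∀ i ∈ s, ContDiff ℝ 1 (f i)) :
    toBdryL2 D (normalDeriv D (fun x => ∑ i ∈ s, c i * f i x)) =
      ∑ i ∈ s, c i • toBdryL2 D (normalDeriv D (f i)) := by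
  have hs : ContDiff ℝ 1 fun x => ∑ i ∈ s, c i * f i x :=
    ContDiff.sum fun i hi => contDiff_const.mul (hf i hi)
  rw [hD.toBdryL2_eq hs]
  apply Lp.ext
  refine (MemLp.coeFn_toLp _).trans ((Lp.coeFn_finsetSum s _).trans ?_).symm
  have h1 : ∀ i ∈ s, ∀ᵐ x ∂(bdryMeasure D),
      (c i • toBdryL2 D (normalDeriv D (f i)) : BdryL2 D) x = c i * normalDeriv D (f i) x := by
    intro i hi
    rw [hD.toBdryL2_eq (hf i hi)]
    filter_upwards [Lp.coeFn_smul (c i) (hD.memLp_normalDeriv (hf i hi)).toLp,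
      (hD.memLp_normalDeriv (hf i hi)).coeFn_toLp] with x h2 h3
    rw [h2, Pi.smul_apply, h3, smul_eq_mul]
  filter_upwards [(Finset.eventually_all s).2 h1] with x hx
  rw [Finset.sum_apply, Finset.sum_congr rfl hx, normalDeriv,
    fderiv_fun_sum fun i hi => ((contDiff_const.mul (hf i hi)).differentiable one_ne_zero) x,
    sum_apply]
  refine Finset.sum_congr rfl fun i hi => ?_
  rw [fderiv_const_mul ((hf i hi).differentiable one_ne_zero x)]
  rfl

theorem inverseNP_sum (hD : IsBoundedC2Domain D) {ι : Type*} (s : Finset ι) (c : ι → ℂ)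
    (g : ι → BdryL2 D) :
    inverseNP lam D (∑ i ∈ s, c i • g i) = ∑ i ∈ s, c i • inverseNP lam D (g i) := by
  classical
  induction s using Finset.induction_on with
  | empty => simpa using inverseNP_smul (D := D) (lam := lam) 0 0
  | insert i s hi ih =>
    rw [Finset.sum_insert hi, Finset.sum_insert hi, hD.inverseNP_add, inverseNP_smul, ih]

theorem integrable_mul_coeFn (hD : IsBoundedC2Domain D) {h : ℂ → ℂ} (hh : Continuous h)
    (φ : BdryL2 D) : Integrable (fun x => h x * φ x) (bdryMeasure D) :=
  (hD.memLp_of_continuousOn hh.continuousOn).integrable_mul (Lp.memLp φ)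

theorem polarForm_sum_left (hD : IsBoundedC2Domain D) {ι : Type*} (s : Finset ι) (c : ι → ℂ)
    {f : ι → ℂ → ℂ} (hf : ∀ i ∈ s, ContDiff ℝ 1 (f i)) {h : ℂ → ℂ} (hh : Continuous h) :
    polarForm lam D (fun x => ∑ i ∈ s, c i * f i x) h = ∑ i ∈ s, c i * polarForm lam D (f i) h := by
  simp only [polarForm, ← integral_const_mul]
  rw [hD.toBdryL2_normalDeriv_sum s c hf, hD.inverseNP_sum, ← integral_finsetSum s fun i _ =>
    (hD.integrable_mul_coeFn hh _).const_mul _]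
  refine integral_congr_ae ?_
  have h1 : ∀ i ∈ s, ∀ᵐ x ∂(bdryMeasure D),
      (c i • inverseNP lam D (toBdryL2 D (normalDeriv D (f i))) : BdryL2 D) x =
        c i * inverseNP lam D (toBdryL2 D (normalDeriv D (f i))) x := fun i _ => by
    filter_upwards [Lp.coeFn_smul (c i) (inverseNP lam D (toBdryL2 D (normalDeriv D (f i))))]
      with x hx
    rw [hx, Pi.smul_apply, smul_eq_mul]
  filter_upwards [Lp.coeFn_finsetSum s fun i =>
    c i • inverseNP lam D (toBdryL2 D (normalDeriv D (f i))),
    (Finset.eventually_all s).2 h1] with x hx hx'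
  rw [hx, Finset.sum_apply, Finset.sum_congr rfl hx', Finset.mul_sum]
  exact Finset.sum_congr rfl fun i _ => mul_left_comm _ _ _

theorem polarForm_sum_right (hD : IsBoundedC2Domain D) {ι : Type*} (s : Finset ι) (c : ι → ℂ)
    (f : ℂ → ℂ) {h : ι → ℂ → ℂ} (hh : ∀ i ∈ s, Continuous (h i)) :
    polarForm lam D f (fun x => ∑ i ∈ s, c i * h i x) = ∑ i ∈ s, c i * polarForm lam D f (h i) := by
  simp only [polarForm, ← integral_const_mul]
  rw [← integral_finsetSum s fun i hi => (hD.integrable_mul_coeFn (hh i hi) _).const_mul _]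
  refine integral_congr_ae (ae_of_all _ fun x => ?_)
  simp only [Finset.sum_mul, mul_assoc]

theorem polarForm_sum_sum (hD : IsBoundedC2Domain D) {ι ι' : Type*} (s : Finset ι)
    (t : Finset ι') (c : ι → ℂ) (d : ι' → ℂ) {f : ι → ℂ → ℂ} {h : ι' → ℂ → ℂ}
    (hf : ∀ i ∈ s, ContDiff ℝ 1 (f i)) (hh : ∀ j ∈ t, Continuous (h j)) :
    polarForm lam D (fun x => ∑ i ∈ s, c i * f i x) (fun x => ∑ j ∈ t, d j * h j x) =
      ∑ i ∈ s, ∑ j ∈ t, c i * d j * polarForm lam D (f i) (h j) := by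
  have hcont : Continuous fun x => ∑ j ∈ t, d j * h j x :=
    continuous_finsetSum _ fun j hj => continuous_const.mul (hh j hj)
  rw [hD.polarForm_sum_left s c hf hcont]
  refine Finset.sum_congr rfl fun i _ => ?_
  rw [hD.polarForm_sum_right t d _ hh, Finset.mul_sum]
  exact Finset.sum_congr rfl fun j _ => (mul_assoc _ _ _).symm

end IsBoundedC2Domain

end

/-! ### The complex contracted polarization tensors -/

theorem contDiff_planeMonomial (α : ℕ × ℕ) : ContDiff ℝ 1 (planeMonomial α) :=
  Complex.ofRealCLM.contDiff.comp
    ((Complex.reCLM.contDiff.pow α.1).mul (Complex.imCLM.contDiff.pow α.2))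

theorem planeSim_one_zero_image (D : Set ℂ) : planeSim 1 0 one_ne_zero '' D = D := by
  simp [Set.image]

theorem contDiff_planeSim {a b : ℂ} (ha : a ≠ 0) : ContDiff ℝ 1 (planeSim a b ha) :=
  (contDiff_const.mul contDiff_id).add contDiff_const

theorem sum_coeff_mul_planeMonomial (m : ℕ) (x : ℂ) :
    ∑ α ∈ Finset.HasAntidiagonal.antidiagonal m,
      ((coeffA m α : ℂ) + Complex.I * coeffB m α) * planeMonomial α x = x ^ m := by
  rw [pow_eq_sum_coeff, Finset.mul_sum, ← Finset.sum_add_distrib]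
  exact Finset.sum_congr rfl fun α _ => by ring

theorem sum_conj_coeff_mul_planeMonomial (m : ℕ) (x : ℂ) :
    ∑ α ∈ Finset.HasAntidiagonal.antidiagonal m,
      ((coeffA m α : ℂ) - Complex.I * coeffB m α) * planeMonomial α x =
        (starRingEnd ℂ) (x ^ m) := by
  rw [← sum_coeff_mul_planeMonomial, map_sum]
  refine Finset.sum_congr rfl fun α _ => ?_
  simp only [map_mul, map_add, Complex.conj_ofReal, Complex.conj_I, planeMonomial]
  ring

theorem complexCGPT1_eq_sum (lam : ℝ) (D : Set ℂ) (m n : ℕ) :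
    complexCGPT1 lam D m n = ∑ α ∈ Finset.HasAntidiagonal.antidiagonal m,
      ∑ β ∈ Finset.HasAntidiagonal.antidiagonal n,
        ((coeffA m α : ℂ) + Complex.I * coeffB m α) *
          ((coeffA n β : ℂ) + Complex.I * coeffB n β) * gpt lam D α β := by
  simp only [complexCGPT1, cgptCC, cgptSS, cgptCS, cgptSC, contractGPT, Finset.mul_sum,
    ← Finset.sum_add_distrib, ← Finset.sum_sub_distrib]
  refine Finset.sum_congr rfl fun α _ => Finset.sum_congr rfl fun β _ => ?_
  linear_combination (-(coeffB m α : ℂ) * coeffB n β * gpt lam D α β) * Complex.I_mul_I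

theorem complexCGPT2_eq_sum (lam : ℝ) (D : Set ℂ) (m n : ℕ) :
    complexCGPT2 lam D m n = ∑ α ∈ Finset.HasAntidiagonal.antidiagonal m,
      ∑ β ∈ Finset.HasAntidiagonal.antidiagonal n,
        ((coeffA m α : ℂ) - Complex.I * coeffB m α) *
          ((coeffA n β : ℂ) + Complex.I * coeffB n β) * gpt lam D α β := by
  simp only [complexCGPT2, cgptCC, cgptSS, cgptCS, cgptSC, contractGPT, Finset.mul_sum,
    ← Finset.sum_add_distrib, ← Finset.sum_sub_distrib]
  refine Finset.sum_congr rfl fun α _ => Finset.sum_congr rfl fun β _ => ?_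
  linear_combination ((coeffB m α : ℂ) * coeffB n β * gpt lam D α β) * Complex.I_mul_I

namespace IsBoundedC2Domain

variable {D : Set ℂ} {lam : ℝ} {a b : ℂ}

/-- `N⁽¹⁾_{mn}` of the image of `D` under a similarity `T` is the polarization form of `D` on the
pair `(T x) ^ m`, `(T x) ^ n`. -/
theorem complexCGPT1_planeSim_image (hD : IsBoundedC2Domain D) (ha : a ≠ 0) (m n : ℕ) :
    complexCGPT1 lam (planeSim a b ha '' D) m n =
      polarForm lam D (fun x => (a * x + b) ^ m) (fun x => (a * x + b) ^ n) := by
  simp only [← sum_coeff_mul_planeMonomial]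
  rw [hD.polarForm_sum_sum (f := fun α x => planeMonomial α (a * x + b))
    (h := fun α x => planeMonomial α (a * x + b)), complexCGPT1_eq_sum]
  · refine Finset.sum_congr rfl fun α _ => Finset.sum_congr rfl fun β _ => ?_
    congr 1
    exact polarForm_planeSim_image ha ((contDiff_planeMonomial α).differentiable one_ne_zero) _
  · exact fun α _ => (contDiff_planeMonomial α).comp (contDiff_planeSim ha)
  · exact fun α _ => ((contDiff_planeMonomial α).comp (contDiff_planeSim ha)).continuous

/-- `N⁽²⁾_{mn}` of the image of `D` under a similarity `T` is the polarization form of `D` on the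
pair `conj ((T x) ^ m)`, `(T x) ^ n`. -/
theorem complexCGPT2_planeSim_image (hD : IsBoundedC2Domain D) (ha : a ≠ 0) (m n : ℕ) :
    complexCGPT2 lam (planeSim a b ha '' D) m n =
      polarForm lam D (fun x => (starRingEnd ℂ) ((a * x + b) ^ m)) (fun x => (a * x + b) ^ n) := by
  have e1 := funext fun x => (sum_conj_coeff_mul_planeMonomial m (a * x + b)).symm
  have e2 := funext fun x => (sum_coeff_mul_planeMonomial n (a * x + b)).symm
  rw [e1, e2]
  rw [hD.polarForm_sum_sum (f := fun α x => planeMonomial α (a * x + b))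
    (h := fun α x => planeMonomial α (a * x + b)), complexCGPT2_eq_sum]
  · refine Finset.sum_congr rfl fun α _ => Finset.sum_congr rfl fun β _ => ?_
    congr 1
    exact polarForm_planeSim_image ha ((contDiff_planeMonomial α).differentiable one_ne_zero) _
  · exact fun α _ => (contDiff_planeMonomial α).comp (contDiff_planeSim ha)
  · exact fun α _ => ((contDiff_planeMonomial α).comp (contDiff_planeSim ha)).continuous

theorem complexCGPT1_eq_polarForm (hD : IsBoundedC2Domain D) (m n : ℕ) :
    complexCGPT1 lam D m n = polarForm lam D (fun x => x ^ m) (fun x => x ^ n) := by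
  have h := hD.complexCGPT1_planeSim_image (lam := lam) (b := 0) one_ne_zero m n
  simpa [planeSim_one_zero_image] using h

theorem complexCGPT2_eq_polarForm (hD : IsBoundedC2Domain D) (m n : ℕ) :
    complexCGPT2 lam D m n =
      polarForm lam D (fun x => (starRingEnd ℂ) (x ^ m)) (fun x => x ^ n) := by
  have h := hD.complexCGPT2_planeSim_image (lam := lam) (b := 0) one_ne_zero m n
  simpa [planeSim_one_zero_image] using h

theorem polarForm_mul_mul (hD : IsBoundedC2Domain D) (c d : ℂ) {f h : ℂ → ℂ}
    (hf : ContDiff ℝ 1 f) (hh : Continuous h) :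
    polarForm lam D (fun x => c * f x) (fun x => d * h x) = c * d * polarForm lam D f h := by
  simpa using hD.polarForm_sum_sum (lam := lam) {()} {()} (fun _ => c) (fun _ => d)
    (f := fun _ => f) (h := fun _ => h) (fun _ _ => hf) (fun _ _ => hh)

theorem complexCGPT1_dilation (hD : IsBoundedC2Domain D) (ha : a ≠ 0) (m n : ℕ) :
    complexCGPT1 lam (planeSim a 0 ha '' D) m n = a ^ (m + n) * complexCGPT1 lam D m n := by
  rw [hD.complexCGPT1_planeSim_image, hD.complexCGPT1_eq_polarForm]
  simp only [add_zero, mul_pow]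
  rw [hD.polarForm_mul_mul _ _ (by fun_prop) (by fun_prop), pow_add]

theorem contDiff_conj_pow (m : ℕ) : ContDiff ℝ 1 fun x : ℂ => (starRingEnd ℂ) (x ^ m) :=
  Complex.conjCLE.contDiff.comp (contDiff_id.pow m)

theorem complexCGPT2_dilation (hD : IsBoundedC2Domain D) (ha : a ≠ 0) (m n : ℕ) :
    complexCGPT2 lam (planeSim a 0 ha '' D) m n =
      (starRingEnd ℂ) a ^ m * a ^ n * complexCGPT2 lam D m n := by
  rw [hD.complexCGPT2_planeSim_image, hD.complexCGPT2_eq_polarForm]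
  simp only [add_zero, mul_pow, map_mul]
  rw [hD.polarForm_mul_mul _ _ (contDiff_conj_pow m) (by fun_prop), map_pow]

/-- The binomial theorem, in terms of the matrix `C^z`. -/
theorem add_pow_eq_sum_shiftMatrix (z x : ℂ) (m : ℕ) :
    (x + z) ^ m = ∑ l ∈ Finset.range (m + 1), shiftMatrix z m l * x ^ l := by
  rw [add_pow]
  exact Finset.sum_congr rfl fun l _ => by rw [shiftMatrix]; ring

theorem sum_range_eq_sum_Icc {M : Type*} [AddCommMonoid M] (m : ℕ) {F : ℕ → M} (h0 : F 0 = 0) :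
    ∑ l ∈ Finset.range (m + 1), F l = ∑ l ∈ Finset.Icc 1 m, F l := by
  symm
  refine Finset.sum_subset (fun l hl => ?_) fun l hl hl' => ?_
  · simp only [Finset.mem_Icc, Finset.mem_range] at hl ⊢
    omega
  · have : l = 0 := by
      simp only [Finset.mem_Icc, Finset.mem_range] at hl hl'
      omega
    rw [this, h0]

/-- The polarization form does not see constants in its first argument. -/
theorem polarForm_one_left (hD : IsBoundedC2Domain D) (h : ℂ → ℂ) :
    polarForm lam D (fun _ => 1) h = 0 := by
  have h0 : toBdryL2 D (normalDeriv D fun _ => 1) = 0 := by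
    rw [hD.toBdryL2_eq contDiff_const]
    apply Lp.ext
    filter_upwards [(hD.memLp_normalDeriv (contDiff_const (c := (1 : ℂ)))).coeFn_toLp,
      Lp.coeFn_zero ℂ 2 (bdryMeasure D)] with x h1 h2
    rw [h1, h2, normalDeriv, fderiv_fun_const]
    rfl
  have h1 : inverseNP lam D 0 = 0 := by simpa using inverseNP_smul (D := D) (lam := lam) 0 0
  rw [polarForm, h0, h1]
  refine integral_eq_zero_of_ae ?_
  filter_upwards [Lp.coeFn_zero ℂ 2 (bdryMeasure D)] with x hx
  rw [hx, Pi.zero_apply, mul_zero]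

theorem complexCGPT1_shift (hD : IsBoundedC2Domain D) (hlam : lam ≠ 1 / 2) (z : ℂ) (m n : ℕ) :
    complexCGPT1 lam (planeSim 1 z one_ne_zero '' D) m n =
      ∑ l ∈ Finset.Icc 1 m, ∑ k ∈ Finset.Icc 1 n,
        shiftMatrix z m l * complexCGPT1 lam D l k * shiftMatrix z n k := by
  rw [hD.complexCGPT1_planeSim_image]
  simp only [one_mul, add_pow_eq_sum_shiftMatrix]
  rw [hD.polarForm_sum_sum _ _ _ _ (fun l _ => by fun_prop) (fun k _ => by fun_prop),
    sum_range_eq_sum_Icc]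
  · refine Finset.sum_congr rfl fun l _ => ?_
    rw [sum_range_eq_sum_Icc]
    · refine Finset.sum_congr rfl fun k _ => ?_
      rw [hD.complexCGPT1_eq_polarForm]
      ring
    · simp only [pow_zero]
      rw [hD.polarForm_one_right hlam (by fun_prop) (hD.integral_normalDeriv_pow l),
        mul_zero]
  · simp only [pow_zero, hD.polarForm_one_left, mul_zero, Finset.sum_const_zero]

theorem complexCGPT2_shift (hD : IsBoundedC2Domain D) (hlam : lam ≠ 1 / 2) (z : ℂ) (m n : ℕ) :
    complexCGPT2 lam (planeSim 1 z one_ne_zero '' D) m n =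
      ∑ l ∈ Finset.Icc 1 m, ∑ k ∈ Finset.Icc 1 n,
        (starRingEnd ℂ) (shiftMatrix z m l) * complexCGPT2 lam D l k * shiftMatrix z n k := by
  rw [hD.complexCGPT2_planeSim_image]
  simp only [one_mul, add_pow_eq_sum_shiftMatrix, map_sum, map_mul _ (shiftMatrix _ _ _)]
  rw [hD.polarForm_sum_sum _ _ _ _ (fun l _ => contDiff_conj_pow l) (fun k _ => by fun_prop),
    sum_range_eq_sum_Icc]
  · refine Finset.sum_congr rfl fun l _ => ?_
    rw [sum_range_eq_sum_Icc]
    · refine Finset.sum_congr rfl fun k _ => ?_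
      rw [hD.complexCGPT2_eq_polarForm]
      ring
    · simp only [pow_zero]
      rw [hD.polarForm_one_right hlam (contDiff_conj_pow l)
        (hD.integral_normalDeriv_conj_pow l), mul_zero]
  · simp only [pow_zero, map_one, hD.polarForm_one_left, mul_zero, Finset.sum_const_zero]

end IsBoundedC2Domain

theorem contrast_ne_half {κ : ℝ} (hκ : 1 < κ) : contrast κ ≠ 1 / 2 := by
  rw [contrast, ne_eq, div_eq_iff (by linarith)]
  intro h
  linarith

theorem mainTheorem2 (κ : ℝ) (hκ : 1 < κ) (D : Set ℂ) (hD : IsBoundedC2Domain D)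
    (m n : ℕ) (hm : 1 ≤ m) (hn : 1 ≤ n) :
    (∀ θ : ℝ,
      complexCGPT1 (contrast κ) (rotateSet θ D) m n =
          Complex.exp (Complex.I * ((m : ℂ) + (n : ℂ)) * (θ : ℂ)) *
            complexCGPT1 (contrast κ) D m n ∧
      complexCGPT2 (contrast κ) (rotateSet θ D) m n =
          Complex.exp (Complex.I * ((n : ℂ) - (m : ℂ)) * (θ : ℂ)) *
            complexCGPT2 (contrast κ) D m n) ∧
    (∀ s : ℝ, 0 < s →
      complexCGPT1 (contrast κ) (scaleSet s D) m n =
          (s : ℂ) ^ (m + n) * complexCGPT1 (contrast κ) D m n ∧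
      complexCGPT2 (contrast κ) (scaleSet s D) m n =
          (s : ℂ) ^ (m + n) * complexCGPT2 (contrast κ) D m n) ∧
    (∀ z : ℂ,
      complexCGPT1 (contrast κ) (shiftSet z D) m n =
          ∑ l ∈ Finset.Icc 1 m, ∑ k ∈ Finset.Icc 1 n,
            shiftMatrix z m l * complexCGPT1 (contrast κ) D l k * shiftMatrix z n k ∧
      complexCGPT2 (contrast κ) (shiftSet z D) m n =
          ∑ l ∈ Finset.Icc 1 m, ∑ k ∈ Finset.Icc 1 n,
            (starRingEnd ℂ) (shiftMatrix z m l) * complexCGPT2 (contrast κ) D l k *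
              shiftMatrix z n k) := by
  have hdil : ∀ (a : ℂ) (ha : a ≠ 0), (fun x => a * x) '' D = planeSim a 0 ha '' D :=
    fun a ha => Set.image_congr fun x _ => by simp
  refine ⟨fun θ => ?_, fun s hs => ?_, fun z => ?_⟩
  · have hconj : (starRingEnd ℂ) (Complex.exp (Complex.I * θ)) =
        Complex.exp (-(Complex.I * θ)) := by
      rw [← Complex.exp_conj, map_mul, Complex.conj_I, Complex.conj_ofReal, neg_mul]
    rw [rotateSet, hdil _ (Complex.exp_ne_zero _), hD.complexCGPT1_dilation,
      hD.complexCGPT2_dilation, hconj, ← Complex.exp_nat_mul, ← Complex.exp_nat_mul,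
      ← Complex.exp_nat_mul, ← Complex.exp_add]
    constructor
    · congr 2
      push_cast
      ring
    · congr 2
      ring
  · rw [scaleSet, hdil _ (Complex.ofReal_ne_zero.2 hs.ne'), hD.complexCGPT1_dilation,
      hD.complexCGPT2_dilation, Complex.conj_ofReal, ← pow_add]
    exact ⟨rfl, rfl⟩
  · have hshift : shiftSet z D = planeSim 1 z one_ne_zero '' D :=
      Set.image_congr fun x _ => by simp
    rw [hshift]
    exact ⟨hD.complexCGPT1_shift (contrast_ne_half hκ) z m n,
      hD.complexCGPT2_shift (contrast_ne_half hκ) z m n⟩
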